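/- Let $G$ be a group with neutral element $\varepsilon$, and let $R=\bigoplus_{g\in G}R_g$ be a $G$-graded unital ring, so $R_gR_h\subseteq R_{gh}$. A graded left (respectively right) $R$-module is a left (right) $R$-module $M=\bigoplus_{g\in G}M_g$ with $R_gM_h\subseteq M_{gh}$ (respectively $M_gR_h\subseteq M_{gh}$). Morphisms of graded modules are the $R$-linear maps that preserve degrees. For $\sigma\in G$, the shift $M(\sigma)$ of a graded left module is $M$ with the grading $M(\sigma)_g=M_{g\sigma}$, and the shift $(\sigma)M$ of a graded right module is $M$ with the grading $((\sigma)M)_g=M_{\sigma g}$. A graded module is graded simple if it is non-zero and has no graded submodules other than $0$ and itself. It is graded indecomposable if it is non-zero and is not a direct sum of two non-zero graded submodules. The graded ring $R$ is graded Artinian if it satisfies the descending chain condition on graded left ideals and on graded right ideals. It is graded quasi-Frobenius if it is graded Artinian, $\mathrm{ann}_r(\mathrm{ann}_\ell(A))=A$ for every graded right ideal $A$, and $\mathrm{ann}_\ell(\mathrm{ann}_r(U))=U$ for every graded left ideal $U$. A principal graded indecomposable left (right) $R$-module is one of the factors $P_i$ in a decomposition $R=P_1\oplus\dots\oplus P_n$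 of $R$ into graded indecomposable left (right) ideals. **Theorem.** Let $R$ be a graded Artinian ring. Then $R$ is graded quasi-Frobenius if and only if the following two conditions are satisfied: (i) For every graded simple left $R$-module $S$ there is $\sigma\in G$ such that $S(\sigma)$ embeds into $R$ as a graded left $R$-module, and for every graded simple right $R$-module $S$ there is $\sigma\in G$ such that $(\sigma)S$ embeds into $R$ as a graded right $R$-module. (ii) Every principal graded indecomposable left $R$-module has exactly one graded simple submodule, and every principal graded indecomposable right $R$-module has exactly one graded simple submodule. -/

import Mathlib

/-!
Gradings are indexed by an arbitrary group `G`, not assumed commutative; as in Mathlib's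
`GradedRing`, its operation is written additively (`0` is the neutral element).
A left `R`-module is a `Module R M`, a right `R`-module is a `Module Rᵐᵒᵖ M`
(`MulOpposite.op r • m` is `m r`). In particular a left ideal of `R` is a `Submodule R R` and
a right ideal of `R` is a `Submodule Rᵐᵒᵖ R`. A graded submodule is a submodule `N` with
`N.IsHomogeneous ℳ`.
-/

universe u v

namespace GradedQF

section Modules

variable {G : Type v} [DecidableEq G] (A : Type*) [Ring A]
  {M : Type*} [AddCommGroup M] [Module A M]
  (ℳ : G → AddSubgroup M) [DirectSum.Decomposition ℳ]

/-- Descending chain condition on graded `A`-submodules. -/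
def IsGradedArtinianModule : Prop :=
  WellFoundedLT {N : Submodule A M // N.IsHomogeneous ℳ}

/-- The graded module `M` is graded simple: it is non-zero, and its only graded submodules
are `0` and `M`. -/
def IsGradedSimple : Prop :=
  Nontrivial M ∧ ∀ N : Submodule A M, N.IsHomogeneous ℳ → N = ⊥ ∨ N = ⊤

variable {A}

/-- `N` is a graded submodule of `M` which is a graded simple module. -/
def IsGradedSimpleSubmodule (N : Submodule A M) : Prop :=
  N.IsHomogeneous ℳ ∧ N ≠ ⊥ ∧
    ∀ N' : Submodule A M, N'.IsHomogeneous ℳ → N' ≤ N → N' = ⊥ ∨ N' = N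

/-- `P` is a graded submodule of `M` which is indecomposable as a graded module: it is non-zero
and is not the direct sum of two non-zero graded submodules. -/
def IsGradedIndecomposableSubmodule (P : Submodule A M) : Prop :=
  P.IsHomogeneous ℳ ∧ P ≠ ⊥ ∧
    ∀ N N' : Submodule A M, N.IsHomogeneous ℳ → N'.IsHomogeneous ℳ →
      N ⊔ N' = P → N ⊓ N' = ⊥ → N = ⊥ ∨ N' = ⊥

/-- `P` is one of the factors in a decomposition of `M` as a finite direct sum of graded
indecomposable submodules. For `M = R` viewed as a graded left (right) module over itself these
are the principal graded indecomposable left (right) `R`-modules. -/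
def IsGradedIndecomposableFactor (P : Submodule A M) : Prop :=
  ∃ (n : ℕ) (Q : Fin n → Submodule A M),
    (∀ i, IsGradedIndecomposableSubmodule ℳ (Q i)) ∧ DirectSum.IsInternal Q ∧ ∃ i, Q i = P

end Modules

/-- A linear map is a morphism of graded modules if it preserves degrees. -/
def IsGradedHom {G A M N : Type*} [Ring A] [AddCommGroup M] [Module A M]
    [AddCommGroup N] [Module A N] (ℳ : G → AddSubgroup M) (𝒩 : G → AddSubgroup N)
    (f : M →ₗ[A] N) : Prop :=
  ∀ g : G, ∀ m ∈ ℳ g, f m ∈ 𝒩 g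

/-- The grading of the shift `M(σ)` of a graded left module: `M(σ)_g = M_{gσ}`. -/
def leftShift {G M : Type*} [AddGroup G] [AddCommGroup M] (ℳ : G → AddSubgroup M) (σ : G) :
    G → AddSubgroup M :=
  fun g => ℳ (g + σ)

/-- The grading of the shift `(σ)M` of a graded right module: `((σ)M)_g = M_{σg}`. -/
def rightShift {G M : Type*} [AddGroup G] [AddCommGroup M] (ℳ : G → AddSubgroup M) (σ : G) :
    G → AddSubgroup M :=
  fun g => ℳ (σ + g)

section Rings

variable {G : Type v} [AddGroup G] [DecidableEq G] {R : Type u} [Ring R]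
  (𝒜 : G → AddSubgroup R) [GradedRing 𝒜]

/-- `M_g R_h ⊆ M_{gh}`: the decomposition `ℳ` makes the right `R`-module `M` a graded right
module. (The left analogue is Mathlib's `SetLike.GradedSMul 𝒜 ℳ`.) -/
def IsGradedRightModule {M : Type*} [AddCommGroup M] [Module Rᵐᵒᵖ M]
    (ℳ : G → AddSubgroup M) : Prop :=
  ∀ g h : G, ∀ m ∈ ℳ g, ∀ r ∈ 𝒜 h, MulOpposite.op r • m ∈ ℳ (g + h)

/-- Descending chain condition on graded left ideals and on graded right ideals. -/
def IsGradedArtinian : Prop :=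
  IsGradedArtinianModule R 𝒜 ∧ IsGradedArtinianModule Rᵐᵒᵖ 𝒜

/-- `ann_ℓ(X) = {a | a x = 0 for all x ∈ X}`. -/
def leftAnn (X : Set R) : Set R := {a | ∀ x ∈ X, a * x = 0}

/-- `ann_r(X) = {a | x a = 0 for all x ∈ X}`. -/
def rightAnn (X : Set R) : Set R := {a | ∀ x ∈ X, x * a = 0}

/-- Graded quasi-Frobenius rings: graded Artinian on both sides, with the double annihilator
condition for graded right ideals and for graded left ideals. -/
def IsGradedQuasiFrobenius : Prop :=
  IsGradedArtinian 𝒜 ∧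
  (∀ I : Submodule Rᵐᵒᵖ R, I.IsHomogeneous 𝒜 → rightAnn (leftAnn (I : Set R)) = I) ∧
  (∀ U : Submodule R R, U.IsHomogeneous 𝒜 → leftAnn (rightAnn (U : Set R)) = U)

/-- Every graded simple left `R`-module `S` has a shift `S(σ)` which embeds into `R` in the
category of graded left `R`-modules. -/
def LeftGradedSimplesEmbed : Prop :=
  ∀ (S : Type u) [AddCommGroup S] [Module R S] (𝒮 : G → AddSubgroup S)
    [DirectSum.Decomposition 𝒮] [SetLike.GradedSMul 𝒜 𝒮], IsGradedSimple R 𝒮 →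
      ∃ (σ : G) (f : S →ₗ[R] R), IsGradedHom (leftShift 𝒮 σ) 𝒜 f ∧ Function.Injective f

/-- Every graded simple right `R`-module `S` has a shift `(σ)S` which embeds into `R` in the
category of graded right `R`-modules. -/
def RightGradedSimplesEmbed : Prop :=
  ∀ (S : Type u) [AddCommGroup S] [Module Rᵐᵒᵖ S] (𝒮 : G → AddSubgroup S)
    [DirectSum.Decomposition 𝒮], IsGradedRightModule 𝒜 𝒮 → IsGradedSimple Rᵐᵒᵖ 𝒮 →
      ∃ (σ : G) (f : S →ₗ[Rᵐᵒᵖ] R), IsGradedHom (rightShift 𝒮 σ) 𝒜 f ∧ Function.Injective f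

end Rings

end GradedQF

/-! From quasi-Frobenius to (i) and (ii). If `s` is a homogeneous generator of a graded simple left
module, the kernel of `a ↦ a s` is a proper graded left ideal. By the double annihilator condition
its right annihilator contains a homogeneous `x ≠ 0`, and `a s ↦ a x` embeds the module up to a
shift. A principal indecomposable module is generated by a primitive idempotent `e`, which is local
by Fitting's lemma. If `N` and `N'` in `Re` meet in zero, their right annihilators sum to `R`. Were
both non-zero, `e` would be a sum of two commuting nilpotents.

Conversely, write `1` as a sum of orthogonal primitive idempotents `e i`, where `R (e i)` has simple
socle `R (s i)` and `(e i) R` has simple socle `(t i) R`. Sending `i` to those `k` for which `e k`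
does not kill `R (s i)` is a map on isomorphism classes of idempotents. It is surjective by (i),
hence injective by finiteness: this is the Nakayama permutation (`idemEquiv_of_socleRel`). It
reduces the extension of a homomorphism `Rp → R`, with `Rp` simple, to the case of two simple
elements in one corner `(e k) R (e i)`. There the simple right socle of `(e k) R` and the locality
of `e i` show that the elements differ by a right multiplication
(`exists_mul_eq_of_isLeftSimpleElem`).

That extension property makes the annihilator maps reverse weak covers between graded left and right
ideals (`rightAnnGraded_wcovBy`, `leftAnnGraded_wcovBy`). A length count in modular lattices
(`closure_eq_of_wcovBy`) then gives both double annihilator conditions. Only the submonoid `H` of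
homogeneous elements enters the ring arguments, so shifts disappear from them and right-handed
versions can be read off in the opposite ring. -/

namespace GradedQF

/-! ### Finite pigeonhole modulo an equivalence relation -/

section Pigeonhole

/-- A relation on a finite set which induces a surjective function modulo an equivalence relation
is injective modulo that equivalence relation. -/
theorem rel_injective_of_surjective {ι : Type*} [Finite ι] (r : Setoid ι) (ρ : ι → ι → Prop)
    (huniq : ∀ i k k', ρ i k → ρ i k' → r k k') (hsurj : ∀ k, ∃ i, ρ i k)
    (htotal : ∀ i, ∃ k, ρ i k) (hcongr : ∀ i j k, r i j → ρ i k → ρ j k)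
    {i j k : ι} (hi : ρ i k) (hj : ρ j k) : r i j := by
  choose f hf using htotal
  have hf' : ∀ a b, r a b → r (f a) (f b) := fun a b hab =>
    huniq b _ _ (hcongr a b _ hab (hf a)) (hf b)
  let F : Quotient r → Quotient r := Quotient.map f hf'
  have hF : Function.Surjective F := by
    intro x
    induction x using Quotient.inductionOn with
    | h k =>
      obtain ⟨i, hik⟩ := hsurj k
      exact ⟨⟦i⟧, Quotient.sound (huniq i _ _ (hf i) hik)⟩
  have hinj := Finite.injective_iff_surjective.2 hF
  have hij : r (f i) (f j) :=
    r.trans (huniq i _ _ (hf i) hi) (huniq j _ _ hj (hf j))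
  exact Quotient.exact (hinj (Quotient.sound hij : F ⟦i⟧ = F ⟦j⟧))

end Pigeonhole

/-! ### Local idempotents and simple one-sided ideals relative to a submonoid `H` -/

section HomogeneousElements

variable {R : Type*} [Ring R] {H : Submonoid R}

/-- If an element of `H` is a left multiple of an element of `H`, then the multiplier can be
chosen in `H`. -/
def LeftDivisionClosed (H : Submonoid R) : Prop :=
  ∀ x ∈ H, ∀ z ∈ H, ∀ a, a * x = z → ∃ b ∈ H, b * x = z

/-- If an element of `H` is a right multiple of an element of `H`, then the multiplier can be
chosen in `H`. -/
def RightDivisionClosed (H : Submonoid R) : Prop :=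
  ∀ x ∈ H, ∀ z ∈ H, ∀ a, x * a = z → ∃ b ∈ H, x * b = z

/-- A non-zero idempotent `e ∈ H` such that every element of `H ∩ eRe` is nilpotent or invertible
in `H ∩ eRe`. -/
structure IsLocalIdem (H : Submonoid R) (e : R) : Prop where
  mem : e ∈ H
  idem : e * e = e
  ne_zero : e ≠ 0
  nilpotent_or_unit : ∀ c ∈ H, e * c = c → c * e = c →
    IsNilpotent c ∨ ∃ d ∈ H, e * d = d ∧ d * e = d ∧ c * d = e ∧ d * c = e

/-- `Rx` is a simple left ideal, as far as multiplication by elements of `H` is concerned. -/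
structure IsLeftSimpleElem (H : Submonoid R) (x : R) : Prop where
  mem : x ∈ H
  ne_zero : x ≠ 0
  exists_mul : ∀ a ∈ H, a * x ≠ 0 → ∃ b, b * (a * x) = x

/-- `xR` is a simple right ideal, as far as multiplication by elements of `H` is concerned. -/
structure IsRightSimpleElem (H : Submonoid R) (x : R) : Prop where
  mem : x ∈ H
  ne_zero : x ≠ 0
  exists_mul : ∀ a ∈ H, x * a ≠ 0 → ∃ b, (x * a) * b = x

/-- `s` is contained in every left ideal generated by a non-zero element of `H ∩ Re`. -/
structure IsLeftSocleGenerator (H : Submonoid R) (e s : R) : Prop where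
  mem : s ∈ H
  ne_zero : s ≠ 0
  mul_idem : s * e = s
  exists_mul : ∀ x ∈ H, x ≠ 0 → x * e = x → ∃ a, a * x = s

/-- `t` is contained in every right ideal generated by a non-zero element of `H ∩ eR`. -/
structure IsRightSocleGenerator (H : Submonoid R) (e t : R) : Prop where
  mem : t ∈ H
  ne_zero : t ≠ 0
  idem_mul : e * t = t
  exists_mul : ∀ x ∈ H, x ≠ 0 → e * x = x → ∃ a, x * a = t

theorem IsLeftSimpleElem.mul_right {x c : R} (hx : IsLeftSimpleElem H x) (hc : c ∈ H)
    (h : x * c ≠ 0) : IsLeftSimpleElem H (x * c) where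
  mem := H.mul_mem hx.mem hc
  ne_zero := h
  exists_mul a ha hne := by
    obtain ⟨b, hb⟩ := hx.exists_mul a ha (fun h0 => hne (by rw [← mul_assoc, h0, zero_mul]))
    exact ⟨b, by rw [← mul_assoc, ← mul_assoc, mul_assoc b, hb]⟩

theorem IsLeftSimpleElem.mul_left {x c : R} (hx : IsLeftSimpleElem H x) (hc : c ∈ H)
    (h : c * x ≠ 0) : IsLeftSimpleElem H (c * x) where
  mem := H.mul_mem hc hx.mem
  ne_zero := h
  exists_mul a ha hne := by
    obtain ⟨b, hb⟩ := hx.exists_mul (a * c) (H.mul_mem ha hc) (by rwa [mul_assoc])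
    exact ⟨c * b, by rw [mul_assoc, ← mul_assoc a, hb]⟩

theorem IsLeftSocleGenerator.isLeftSimpleElem {e s : R} (hs : IsLeftSocleGenerator H e s) :
    IsLeftSimpleElem H s where
  mem := hs.mem
  ne_zero := hs.ne_zero
  exists_mul a ha hne :=
    hs.exists_mul _ (H.mul_mem ha hs.mem) hne (by rw [mul_assoc, hs.mul_idem])

/-- The idempotents `e` and `f` are isomorphic via elements of `H`. -/
def IdemEquiv (H : Submonoid R) (e f : R) : Prop :=
  ∃ α ∈ H, ∃ β ∈ H, e * α = α ∧ α * f = α ∧ f * β = β ∧ β * e = β ∧ α * β = e ∧ β * α = f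

theorem IdemEquiv.refl {e : R} (he : e ∈ H) (hi : e * e = e) : IdemEquiv H e e :=
  ⟨e, he, e, he, hi, hi, hi, hi, hi, hi⟩

theorem IdemEquiv.symm {e f : R} : IdemEquiv H e f → IdemEquiv H f e := by
  rintro ⟨α, hα, β, hβ, h1, h2, h3, h4, h5, h6⟩
  exact ⟨β, hβ, α, hα, h3, h4, h1, h2, h6, h5⟩

theorem IdemEquiv.trans {e f g : R} : IdemEquiv H e f → IdemEquiv H f g → IdemEquiv H e g := by
  rintro ⟨α, hα, β, hβ, h1, h2, h3, h4, h5, h6⟩ ⟨γ, hγ, δ, hδ, k1, k2, k3, k4, k5, k6⟩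
  refine ⟨α * γ, H.mul_mem hα hγ, δ * β, H.mul_mem hδ hβ, ?_, ?_, ?_, ?_, ?_, ?_⟩
  · rw [← mul_assoc, h1]
  · rw [mul_assoc, k2]
  · rw [← mul_assoc, k3]
  · rw [mul_assoc, h4]
  · rw [mul_assoc, ← mul_assoc γ, k5, h3, h5]
  · rw [mul_assoc, ← mul_assoc β, h6, k1, k6]

theorem not_isNilpotent_of_mul_eq {c x : R} (hx : x ≠ 0) (h : c * x = x) : ¬ IsNilpotent c := by
  rintro ⟨n, hn⟩
  have : ∀ m : ℕ, c ^ m * x = x := by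
    intro m
    induction m with
    | zero => simp
    | succ m ih => rw [pow_succ, mul_assoc, h, ih]
  exact hx (by rw [← this n, hn, zero_mul])

/-- Iterating gives `v ^ m * (x * c ^ m) = x` for all `m`. This detects units of a local corner from
their action on a simple left ideal. -/
theorem not_isNilpotent_of_mul_mul_eq {v c x : R} (hx : x ≠ 0) (h : v * (x * c) = x) :
    ¬ IsNilpotent c := by
  rintro ⟨n, hn⟩
  have : ∀ m : ℕ, v ^ m * (x * c ^ m) = x := by
    intro m
    induction m with
    | zero => simp
    | succ m ih =>
      calc v ^ (m + 1) * (x * c ^ (m + 1)) = v ^ m * (v * (x * c) * c ^ m) := by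
            rw [pow_succ v, pow_succ' c]; simp only [mul_assoc]
        _ = x := by rw [h, ih]
  exact hx (by rw [← this n, hn, mul_zero, mul_zero])

/-- Local idempotents which act non-trivially on the same simple left ideal are isomorphic. -/
theorem IsLeftSimpleElem.idemEquiv (hl : LeftDivisionClosed H) {s : R}
    (hs : IsLeftSimpleElem H s) {e f a a' : R} (he : IsLocalIdem H e) (hf : IsLocalIdem H f)
    (ha : a ∈ H) (ha' : a' ∈ H) (hne : e * (a * s) ≠ 0) (hne' : f * (a' * s) ≠ 0) :
    IdemEquiv H e f := by
  -- Simplicity gives `b` with `b * (f * a') * s = s`, so `e * (a * b) * f` carries `f * (a' * s)`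
  -- to `e * (a * s)`.
  have key : ∀ {e f a a' : R}, e ∈ H → f ∈ H → e * e = e → f * f = f → a ∈ H → a' ∈ H →
      f * (a' * s) ≠ 0 → ∃ α ∈ H, e * α = α ∧ α * f = α ∧
        α * (f * (a' * s)) = e * (a * s) := by
    intro e f a a' he hf hee hff ha ha' hne'
    obtain ⟨b, hb⟩ := hs.exists_mul (f * a') (H.mul_mem hf ha') (by rwa [mul_assoc])
    obtain ⟨b, hbH, hb⟩ := hl _ (H.mul_mem (H.mul_mem hf ha') hs.mem) _ hs.mem b hb
    refine ⟨e * (a * b) * f, H.mul_mem (H.mul_mem he (H.mul_mem ha hbH)) hf, ?_, ?_, ?_⟩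
    · rw [← mul_assoc, ← mul_assoc, hee]
    · rw [mul_assoc, hff]
    · calc e * (a * b) * f * (f * (a' * s)) = e * (a * (b * ((f * f) * a' * s))) := by
            simp only [mul_assoc]
        _ = e * (a * s) := by rw [hff, hb]
  obtain ⟨α, hα, hα1, hα2, hα3⟩ := key he.mem hf.mem he.idem hf.idem ha ha' hne'
  obtain ⟨β, hβ, hβ1, hβ2, hβ3⟩ := key hf.mem he.mem hf.idem he.idem ha' ha hne
  have h1 : α * β * (e * (a * s)) = e * (a * s) := by rw [mul_assoc, hβ3, hα3]
  have h2 : β * α * (f * (a' * s)) = f * (a' * s) := by rw [mul_assoc, hα3, hβ3]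
  -- `α * β` fixes a non-zero element, so it is not nilpotent and locality of `e` makes it a unit;
  -- likewise `β * α` for `f`.
  obtain ⟨d, hd, hd1, hd2, hd3, hd4⟩ := (he.nilpotent_or_unit (α * β) (H.mul_mem hα hβ)
    (by rw [← mul_assoc, hα1]) (by rw [mul_assoc, hβ2])).resolve_left
    (not_isNilpotent_of_mul_eq hne h1)
  obtain ⟨d', hd', hd1', hd2', hd3', hd4'⟩ := (hf.nilpotent_or_unit (β * α) (H.mul_mem hβ hα)
    (by rw [← mul_assoc, hβ1]) (by rw [mul_assoc, hα2])).resolve_left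
    (not_isNilpotent_of_mul_eq hne' h2)
  -- The right inverse `β * d` of `α` agrees with its left inverse `d' * β`.
  have h3 : β * d = d' * β := by
    calc β * d = f * (β * d) := by rw [← mul_assoc, hβ1]
      _ = d' * (β * α) * (β * d) := by rw [hd4']
      _ = d' * (β * (α * β * d)) := by simp only [mul_assoc]
      _ = d' * β := by rw [hd3, hβ2]
  refine ⟨α, hα, β * d, H.mul_mem hβ hd, hα1, hα2, ?_, ?_, ?_, ?_⟩
  · rw [← mul_assoc, hβ1]
  · rw [mul_assoc, hd2]
  · rw [← mul_assoc, hd3]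
  · rw [h3, mul_assoc, hd4']

/-! ### The Nakayama permutation and extension of maps from simple left ideals -/

section Socle

variable {ι : Type*} {e s t : ι → R}

/-- `e k` acts non-trivially on the left ideal generated by `s i`. -/
def SocleRel (H : Submonoid R) (e s : ι → R) (i k : ι) : Prop :=
  ∃ a ∈ H, e k * (a * s i) ≠ 0

/-- `Rx` is a simple left ideal inside `R (e i)`, hence equals `R (s i)`; so `x` is a multiple of `s
i`, and `e k` fixes it. -/
theorem IsLeftSimpleElem.socleRel (hl : LeftDivisionClosed H)
    (hs : ∀ i, IsLeftSocleGenerator H (e i) (s i)) {x : R} (hx : IsLeftSimpleElem H x) {i k : ι}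
    (hxi : x * e i = x) (hkx : e k * x = x) : SocleRel H e s i k := by
  obtain ⟨c, hc⟩ := (hs i).exists_mul x hx.mem hx.ne_zero hxi
  obtain ⟨c, hcH, hc⟩ := hl _ hx.mem _ (hs i).mem c hc
  obtain ⟨b, hb⟩ := hx.exists_mul c hcH (by rw [hc]; exact (hs i).ne_zero)
  rw [hc] at hb
  obtain ⟨b, hbH, hb⟩ := hl _ (hs i).mem _ hx.mem b hb
  exact ⟨b, hbH, by rw [hb, hkx]; exact hx.ne_zero⟩

variable [Fintype ι]

theorem exists_mul_ne_zero (hsum : ∑ i, e i = 1) {x : R} (hx : x ≠ 0) : ∃ i, e i * x ≠ 0 := by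
  by_contra! h
  exact hx (by rw [← one_mul x, ← hsum, Finset.sum_mul, Finset.sum_eq_zero fun i _ => h i])

theorem exists_mul_ne_zero' (hsum : ∑ i, e i = 1) {x : R} (hx : x ≠ 0) : ∃ i, x * e i ≠ 0 := by
  by_contra! h
  exact hx (by rw [← mul_one x, ← hsum, Finset.mul_sum, Finset.sum_eq_zero fun i _ => h i])

/-- If every local idempotent acts non-trivially on a simple left ideal, then idempotents whose
left socles have the same top are isomorphic. -/
theorem idemEquiv_of_socleRel (hl : LeftDivisionClosed H)
    (he : ∀ i, IsLocalIdem H (e i)) (hsum : ∑ i, e i = 1)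
    (hs : ∀ i, IsLeftSocleGenerator H (e i) (s i))
    (hK : ∀ k, ∃ x, IsLeftSimpleElem H x ∧ e k * x = x) {i j k : ι}
    (hi : SocleRel H e s i k) (hj : SocleRel H e s j k) : IdemEquiv H (e i) (e j) := by
  let r : Setoid ι := ⟨fun i j => IdemEquiv H (e i) (e j),
    fun i => IdemEquiv.refl (he i).mem (he i).idem, IdemEquiv.symm, IdemEquiv.trans⟩
  refine rel_injective_of_surjective r (SocleRel H e s) ?_ ?_ ?_ ?_ hi hj
  · rintro i k k' ⟨a, ha, hne⟩ ⟨a', ha', hne'⟩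
    exact (hs i).isLeftSimpleElem.idemEquiv hl (he k) (he k') ha ha' hne hne'
  -- Surjectivity is where the embedding of simples enters: a simple left ideal not killed by `e k`
  -- projects non-trivially to some `R (e i)` and lands in its socle.
  · intro k
    obtain ⟨x, hx, hkx⟩ := hK k
    obtain ⟨i, hi⟩ := exists_mul_ne_zero' hsum hx.ne_zero
    exact ⟨i, (hx.mul_right (he i).mem hi).socleRel hl hs (by rw [mul_assoc, (he i).idem])
      (by rw [← mul_assoc, hkx])⟩
  · intro i
    obtain ⟨k, hk⟩ := exists_mul_ne_zero hsum (hs i).ne_zero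
    exact ⟨k, 1, H.one_mem, by rwa [one_mul]⟩
  -- Right multiplication by `α` moves `s i` into `R (e j)`. Since `β` undoes it, the image is still
  -- simple and still seen by `e k`.
  · rintro i j k ⟨α, hα, β, hβ, h1, h2, h3, h4, h5, h6⟩ ⟨a, ha, hne⟩
    have hsβ : s i * α * β = s i := by rw [mul_assoc, h5, (hs i).mul_idem]
    have hsα : s i * α ≠ 0 := fun h0 => (hs i).ne_zero (by rw [← hsβ, h0, zero_mul])
    have hx : IsLeftSimpleElem H (e k * (a * (s i * α))) := by
      have h := ((hs i).isLeftSimpleElem.mul_right hα hsα).mul_left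
        (H.mul_mem (he k).mem ha) (c := e k * a) (by
          intro h0
          refine hne ?_
          rw [← hsβ]
          calc e k * (a * (s i * α * β)) = e k * a * (s i * α) * β := by simp only [mul_assoc]
            _ = 0 := by rw [h0, zero_mul])
      rwa [mul_assoc] at h
    refine hx.socleRel hl hs ?_ ?_
    · simp only [mul_assoc]; rw [h2]
    · rw [← mul_assoc, (he k).idem]

/-- Two simple left ideals generated by elements of `H ∩ eₖReᵢ` differ by a right
multiplication. -/
theorem exists_mul_eq_of_isLeftSimpleElem_corner (hl : LeftDivisionClosed H)
    (hr : RightDivisionClosed H) (he : ∀ i, IsLocalIdem H (e i)) (hsum : ∑ i, e i = 1)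
    (hs : ∀ i, IsLeftSocleGenerator H (e i) (s i)) (ht : ∀ i, IsRightSocleGenerator H (e i) (t i))
    (hK : ∀ k, ∃ x, IsLeftSimpleElem H x ∧ e k * x = x) {i k : ι} {p q : R}
    (hp : IsLeftSimpleElem H p) (hq : IsLeftSimpleElem H q)
    (hpi : p * e i = p) (hkp : e k * p = p) (hqi : q * e i = q) (hkq : e k * q = q) :
    ∃ r, p * r = q := by
  obtain ⟨l, hl0⟩ := exists_mul_ne_zero' hsum (ht k).ne_zero
  -- `p` and `q` have a common right multiple in `e k * R * e l`
  have common : ∀ p, IsLeftSimpleElem H p → e k * p = p → ∃ c ∈ H, p * c = t k * e l := by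
    intro p hp hkp
    obtain ⟨c, hc⟩ := (ht k).exists_mul p hp.mem hp.ne_zero hkp
    exact hr _ hp.mem _ (H.mul_mem (ht k).mem (he l).mem) (c * e l) (by rw [← mul_assoc, hc])
  obtain ⟨c, hc, hpc⟩ := common p hp hkp
  have hw : IsLeftSimpleElem H (t k * e l) := by
    rw [← hpc] at hl0 ⊢
    exact hp.mul_right hc hl0
  -- `t k * e l` and `p` give the socles of `R (e l)` and `R (e i)` the same top `e k`; injectivity
  -- of the permutation identifies `e l` with `e i`, so the common multiple moves into the corner of
  -- `p`.
  obtain ⟨γ, hγ, δ, hδ, g1, g2, g3, g4, g5, g6⟩ : IdemEquiv H (e l) (e i) :=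
    idemEquiv_of_socleRel hl he hsum hs hK
      (hw.socleRel hl hs (by rw [mul_assoc, (he l).idem]) (by rw [← mul_assoc, (ht k).idem_mul]))
      (hp.socleRel hl hs hpi hkp)
  set w := t k * e l * γ with hw_def
  have hw0 : w ≠ 0 := by
    intro h0
    refine hl0 ?_
    calc t k * e l = t k * (e l * e l) := by rw [(he l).idem]
      _ = t k * (e l * (γ * δ)) := by rw [g5]
      _ = w * δ := by simp only [hw_def, mul_assoc]
      _ = 0 := by rw [h0, zero_mul]
  have hwH : w ∈ H := H.mul_mem hw.mem hγ
  have hwi : w * e i = w := by rw [hw_def, mul_assoc, g2]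
  -- Any such `p` differs from the fixed element `w` by a unit of the corner at `e i`; applying this
  -- to `p` and to `q` links them through `w`.
  have unit : ∀ p, IsLeftSimpleElem H p → p * e i = p → e k * p = p →
      ∃ a, p * a = w ∧ ∃ d, w * d = p := by
    intro p hp hpi hkp
    obtain ⟨c, hc, hpc⟩ := common p hp hkp
    have hpa : p * (e i * (c * γ)) = w := by
      rw [← mul_assoc, hpi, ← mul_assoc, hpc]
    have hpaw : p * (e i * (c * γ)) ≠ 0 := by rwa [hpa]
    have hws := hp.mul_right (H.mul_mem (he i).mem (H.mul_mem hc hγ)) hpaw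
    -- both `p` and `p * a` generate the socle of `R * e i`
    obtain ⟨x, hx⟩ := (hs i).exists_mul p hp.mem hp.ne_zero hpi
    obtain ⟨x, hxH, hx⟩ := hl _ hp.mem _ (hs i).mem x hx
    obtain ⟨y, hy⟩ := hp.exists_mul x hxH (by rw [hx]; exact (hs i).ne_zero)
    obtain ⟨z, hz⟩ := (hs i).exists_mul _ hws.mem hws.ne_zero (by rw [hpa, hwi])
    have hnil := not_isNilpotent_of_mul_mul_eq (v := y * z) hp.ne_zero
      (by rw [mul_assoc, hz, ← hx, hy])
    obtain ⟨d, -, -, -, hd, -⟩ := ((he i).nilpotent_or_unit _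
      (H.mul_mem (he i).mem (H.mul_mem hc hγ)) (by rw [← mul_assoc, (he i).idem])
      (by rw [mul_assoc, mul_assoc, g2])).resolve_left hnil
    exact ⟨_, hpa, d, by rw [← hpa, mul_assoc, hd, hpi]⟩
  obtain ⟨a, hpa, -⟩ := unit p hp hpi hkp
  obtain ⟨-, -, d, hwd⟩ := unit q hq hqi hkq
  exact ⟨a * d, by rw [← mul_assoc, hpa, hwd]⟩

/-- If `Rp` is a simple left ideal, every homomorphism `Rp → R` which maps `p` into `H` is a right
multiplication. -/
theorem exists_mul_eq_of_isLeftSimpleElem (hl : LeftDivisionClosed H)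
    (hr : RightDivisionClosed H) (he : ∀ i, IsLocalIdem H (e i)) (hsum : ∑ i, e i = 1)
    (hs : ∀ i, IsLeftSocleGenerator H (e i) (s i)) (ht : ∀ i, IsRightSocleGenerator H (e i) (t i))
    (hK : ∀ k, ∃ x, IsLeftSimpleElem H x ∧ e k * x = x) {p q : R}
    (hp : IsLeftSimpleElem H p) (hq : q ∈ H) (hpq : ∀ a, a * p = 0 → a * q = 0) :
    ∃ r, p * r = q := by
  have main : ∀ j, ∃ r, p * r = q * e j := by
    intro j
    by_cases hqj : q * e j = 0
    · exact ⟨0, by rw [mul_zero, hqj]⟩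
    -- This says that `a * p ↦ a * (q * e j)` is well defined; so `q * e j`, if non-zero, generates
    -- a simple left ideal.
    have transfer : ∀ a b, a * p = b * p → a * (q * e j) = b * (q * e j) := by
      intro a b h
      have := hpq (a - b) (by rw [sub_mul, h, sub_self])
      rw [sub_mul, sub_eq_zero] at this
      rw [← mul_assoc, this, mul_assoc]
    have hq' : IsLeftSimpleElem H (q * e j) :=
      { mem := H.mul_mem hq (he j).mem
        ne_zero := hqj
        exists_mul := by
          intro a ha hne
          obtain ⟨b, hb⟩ := hp.exists_mul a ha fun h0 => hne (by
            have := transfer a 0 (by rw [h0, zero_mul])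
            rwa [zero_mul] at this)
          refine ⟨b, ?_⟩
          have := transfer (b * a) 1 (by rw [mul_assoc, hb, one_mul])
          rwa [mul_assoc, one_mul] at this }
    obtain ⟨k, hk⟩ := exists_mul_ne_zero hsum hp.ne_zero
    obtain ⟨b, hb⟩ := hp.exists_mul _ (he k).mem hk
    have hbq : b * (e k * (q * e j)) = q * e j := by
      have := transfer (b * e k) 1 (by rw [mul_assoc, hb, one_mul])
      rwa [mul_assoc, one_mul] at this
    have hkq : e k * (q * e j) ≠ 0 := fun h0 => hqj (by rw [← hbq, h0, mul_zero])
    obtain ⟨i, hi⟩ := exists_mul_ne_zero' hsum hk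
    have hP := (hp.mul_left (he k).mem hk).mul_right (he i).mem hi
    have hQ := hq'.mul_left (he k).mem hkq
    have hPi : e k * p * e i * e i = e k * p * e i := by rw [mul_assoc, (he i).idem]
    have hkP : e k * (e k * p * e i) = e k * p * e i := by
      rw [← mul_assoc, ← mul_assoc, (he k).idem]
    have hQj : e k * (q * e j) * e j = e k * (q * e j) := by
      rw [mul_assoc, mul_assoc, (he j).idem]
    have hkQ : e k * (e k * (q * e j)) = e k * (q * e j) := by rw [← mul_assoc, (he k).idem]
    -- Both socles have top `e k`, hence `e i` and `e j` are isomorphic; multiplying by `β` brings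
    -- `e k * (q * e j)` into the corner of `e k * p * e i`, and `α` brings the result back.
    obtain ⟨α, hα, β, hβ, h1, h2, h3, h4, h5, h6⟩ : IdemEquiv H (e i) (e j) :=
      idemEquiv_of_socleRel hl he hsum hs hK (hP.socleRel hl hs hPi hkP)
        (hQ.socleRel hl hs hQj hkQ)
    have hβα : e k * (q * e j) * β * α = e k * (q * e j) := by rw [mul_assoc, h6, hQj]
    have hQβ := hQ.mul_right hβ fun h0 => hkq (by rw [← hβα, h0, zero_mul])
    obtain ⟨r, hr'⟩ := exists_mul_eq_of_isLeftSimpleElem_corner hl hr he hsum hs ht hK hP hQβ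
      hPi hkP (by rw [mul_assoc, h4]) (by rw [← mul_assoc, hkQ])
    refine ⟨e i * r * α, ?_⟩
    calc p * (e i * r * α) = b * (e k * p) * (e i * r * α) := by rw [hb]
      _ = b * (e k * p * e i * r * α) := by simp only [mul_assoc]
      _ = q * e j := by rw [hr', hβα, hbq]
  choose r hr' using main
  exact ⟨∑ j, r j, by rw [Finset.mul_sum, Finset.sum_congr rfl fun j _ => hr' j,
    ← Finset.mul_sum, hsum, mul_one]⟩

end Socle

end HomogeneousElements

end GradedQF

namespace GradedQF

/-! ### Length arguments in modular lattices -/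

section ModularLattice

/-- There is a chain `⊥ = a₀ ⩿ a₁ ⩿ ⋯ ⩿ aₙ = a`. -/
inductive HasWeakSeries {α : Type*} [Preorder α] [OrderBot α] : ℕ → α → Prop
  | bot : HasWeakSeries 0 ⊥
  | step {n : ℕ} {a b : α} : HasWeakSeries n a → a ⩿ b → HasWeakSeries (n + 1) b

variable {α : Type*} [Lattice α] [OrderBot α]

/-- Intersect the chain with `u`. When `u` is not below `a`, modularity transposes the top step to
`a ⊓ u ⋖ u`, and `a ⊓ u < a` supplies the strict drop by induction. -/
theorem HasWeakSeries.exists_lt [IsModularLattice α] {n : ℕ} {a : α} (h : HasWeakSeries n a) :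
    ∀ u < a, ∃ m < n, HasWeakSeries m u := by
  induction h with
  | bot => exact fun u hu => absurd hu not_lt_bot
  | @step n a b ha hab ih =>
    intro u hu
    by_cases hua : u ≤ a
    · rcases hua.lt_or_eq with hlt | rfl
      · obtain ⟨m, hm, hmu⟩ := ih u hlt
        exact ⟨m, hm.trans n.lt_succ_self, hmu⟩
      · exact ⟨n, n.lt_succ_self, ha⟩
    have hsup : a ⊔ u = b :=
      (hab.eq_or_eq le_sup_left (sup_le hab.le hu.le)).resolve_left fun h => hua (sup_eq_left.1 h)
    have hinf : a ⊓ u < a := by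
      refine inf_le_left.lt_of_ne fun h => ?_
      rw [inf_eq_left] at h
      rw [sup_eq_right.2 h] at hsup
      exact hu.ne hsup
    have hne : a ≠ b := fun h => hua (h ▸ hu.le)
    have hcov : a ⊓ u ⋖ u := by
      have := hab.covBy_of_ne hne
      rw [← hsup] at this
      exact inf_covBy_of_covBy_sup_left this
    obtain ⟨m, hm, hmu⟩ := ih _ hinf
    exact ⟨m + 1, Nat.succ_lt_succ hm, hmu.step hcov.wcovBy⟩

/-- An extensive map which preserves `⊥` and weak covers fixes the elements of finite length. -/
theorem eq_of_hasWeakSeries [IsModularLattice α] {Φ : α → α} (hbot : Φ ⊥ = ⊥)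
    (hle : ∀ a, a ≤ Φ a) (hcov : ∀ a b, a ⩿ b → Φ a ⩿ Φ b) {n : ℕ} {a : α}
    (ha : HasWeakSeries n a) : Φ a = a := by
  -- Weak covers are used because `Φ` may collapse a step; the image chain then keeps the same
  -- formal length.
  have hΦ : ∀ {n a}, HasWeakSeries n a → HasWeakSeries n (Φ a) := by
    intro n a h
    induction h with
    | bot => rw [hbot]; exact .bot
    | step _ hab ih => exact ih.step (hcov _ _ hab)
  classical
  have hex : ∃ n, HasWeakSeries n a := ⟨n, ha⟩
  by_contra hne
  -- With minimal length for `a`, the image `Φ a` has a series of that length, so `a < Φ a` would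
  -- give `a` a shorter one.
  obtain ⟨m, hm, hma⟩ := (hΦ (Nat.find_spec hex)).exists_lt a ((hle a).lt_of_ne (Ne.symm hne))
  exact Nat.find_min hex hm hma

/-- A Galois connection between lattices with descending chain condition which reverses weak
covers in both directions and maps the smallest element of `α` to a closed element is perfect
on the side of `α`. -/
theorem closure_eq_of_wcovBy {β : Type*} [PartialOrder β] [IsModularLattice α]
    [OrderTop α] [WellFoundedLT α] [WellFoundedLT β] {f : α → β} {g : β → α}
    (hf : Antitone f) (hgf : ∀ a, a ≤ g (f a)) (hbot : g (f ⊥) = ⊥)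
    (hfcov : ∀ a b, a ⩿ b → f b ⩿ f a) (hgcov : ∀ a b, a ⩿ b → g b ⩿ g a) (a : α) :
    g (f a) = a := by
  have hfix : ∀ {n a}, HasWeakSeries n a → g (f a) = a := fun h =>
    eq_of_hasWeakSeries (Φ := fun a => g (f a)) hbot hgf
      (fun a b hab => hgcov _ _ (hfcov _ _ hab)) h
  -- Descending chains in `β` bound the length of `α`: take `u` of finite length with `f u` minimal.
  -- A next element `w` above `u` would have `f w = f u`, although `g ∘ f` fixes both.
  have htop : ∃ n, HasWeakSeries n (⊤ : α) := by
    obtain ⟨y, ⟨n, u, hu, rfl⟩, hmin⟩ := wellFounded_lt.has_min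
      {y : β | ∃ n u, HasWeakSeries n u ∧ f u = y} ⟨_, 0, ⊥, .bot, rfl⟩
    rcases eq_or_ne u ⊤ with rfl | hne
    · exact ⟨n, hu⟩
    obtain ⟨w, hw, hwmin⟩ := wellFounded_lt.has_min {w : α | u < w} ⟨⊤, hne.lt_top⟩
    have hs : HasWeakSeries (n + 1) w :=
      hu.step ⟨(show u < w from hw).le, fun c huc hcw => hwmin c huc hcw⟩
    have hfw : f w = f u := by
      by_contra h
      exact hmin _ ⟨_, w, hs, rfl⟩ ((hf (show u < w from hw).le).lt_of_ne h)
    refine absurd ?_ (show u < w from hw).ne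
    rw [← hfix hu, ← hfix hs, hfw]
  obtain ⟨n, hn⟩ := htop
  rcases eq_or_ne a ⊤ with rfl | hne
  · exact hfix hn
  · obtain ⟨m, -, hm⟩ := hn.exists_lt a hne.lt_top
    exact hfix hm

end ModularLattice

/-! ### Transfer to right ideals through the opposite ring -/

section Opposite

open MulOpposite

variable {R : Type*} [Ring R] {H : Submonoid R}

theorem LeftDivisionClosed.op (h : LeftDivisionClosed H) : RightDivisionClosed H.op := by
  intro x hx z hz a ha
  obtain ⟨b, hb, hbx⟩ := h x.unop hx z.unop hz a.unop (by rw [← unop_mul, ha])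
  exact ⟨.op b, hb, unop_injective hbx⟩

theorem RightDivisionClosed.op (h : RightDivisionClosed H) : LeftDivisionClosed H.op := by
  intro x hx z hz a ha
  obtain ⟨b, hb, hbx⟩ := h x.unop hx z.unop hz a.unop (by rw [← unop_mul, ha])
  exact ⟨.op b, hb, unop_injective hbx⟩

theorem IsLocalIdem.op {e : R} (he : IsLocalIdem H e) : IsLocalIdem H.op (op e) where
  mem := he.mem
  idem := unop_injective he.idem
  ne_zero := (op_ne_zero_iff e).2 he.ne_zero
  nilpotent_or_unit c hc h1 h2 := by
    rcases he.nilpotent_or_unit c.unop hc (op_injective h2) (op_injective h1) with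
      ⟨n, hn⟩ | ⟨d, hd, h3, h4, h5, h6⟩
    · exact .inl ⟨n, unop_injective (by rw [unop_pow, hn, unop_zero])⟩
    · exact .inr ⟨.op d, hd, unop_injective h4, unop_injective h3, unop_injective h6,
        unop_injective h5⟩

theorem IsRightSimpleElem.op {x : R} (hx : IsRightSimpleElem H x) :
    IsLeftSimpleElem H.op (op x) where
  mem := hx.mem
  ne_zero := (op_ne_zero_iff x).2 hx.ne_zero
  exists_mul a ha hne := by
    obtain ⟨b, hb⟩ := hx.exists_mul a.unop ha fun h => hne (unop_injective h)
    exact ⟨.op b, unop_injective hb⟩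

theorem IsRightSocleGenerator.op {e t : R} (ht : IsRightSocleGenerator H e t) :
    IsLeftSocleGenerator H.op (op e) (op t) where
  mem := ht.mem
  ne_zero := (op_ne_zero_iff t).2 ht.ne_zero
  mul_idem := unop_injective ht.idem_mul
  exists_mul x hx hne h := by
    obtain ⟨a, ha⟩ := ht.exists_mul x.unop hx ((unop_ne_zero_iff x).2 hne) (op_injective h)
    exact ⟨.op a, unop_injective ha⟩

theorem IsLeftSocleGenerator.op {e s : R} (hs : IsLeftSocleGenerator H e s) :
    IsRightSocleGenerator H.op (op e) (op s) where
  mem := hs.mem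
  ne_zero := (op_ne_zero_iff s).2 hs.ne_zero
  idem_mul := unop_injective hs.mul_idem
  exists_mul x hx hne h := by
    obtain ⟨a, ha⟩ := hs.exists_mul x.unop hx ((unop_ne_zero_iff x).2 hne) (op_injective h)
    exact ⟨.op a, unop_injective ha⟩

/-- If `pR` is a simple right ideal, every homomorphism `pR → R` which maps `p` into `H` is a left
multiplication. -/
theorem exists_mul_eq_of_isRightSimpleElem (hl : LeftDivisionClosed H)
    (hr : RightDivisionClosed H) {ι : Type*} [Fintype ι] {e s t : ι → R}
    (he : ∀ i, IsLocalIdem H (e i)) (hsum : ∑ i, e i = 1)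
    (hs : ∀ i, IsLeftSocleGenerator H (e i) (s i)) (ht : ∀ i, IsRightSocleGenerator H (e i) (t i))
    (hK : ∀ k, ∃ x, IsRightSimpleElem H x ∧ x * e k = x) {p q : R}
    (hp : IsRightSimpleElem H p) (hq : q ∈ H) (hpq : ∀ a, p * a = 0 → q * a = 0) :
    ∃ r, r * p = q := by
  obtain ⟨r, hr'⟩ := exists_mul_eq_of_isLeftSimpleElem (H := H.op) hr.op hl.op
    (fun i => (he i).op) (by rw [← Finset.op_sum, hsum, op_one]) (fun i => (ht i).op)
    (fun i => (hs i).op) (fun k => by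
      obtain ⟨x, hx, hxk⟩ := hK k
      exact ⟨_, hx.op, unop_injective hxk⟩) hp.op (q := .op q) hq
    (fun a ha => unop_injective (hpq _ (op_injective ha)))
  exact ⟨r.unop, op_injective hr'⟩

end Opposite

/-! ### Primitive idempotents are local -/

section Fitting

variable {R : Type*} [Ring R] {H : Submonoid R}

/-- `e ∈ H` is a non-zero idempotent, and `0` and `e` are the only idempotents in `H ∩ eRe`. -/
structure IsPrimitiveIdem (H : Submonoid R) (e : R) : Prop where
  mem : e ∈ H
  idem : e * e = e
  ne_zero : e ≠ 0
  eq_zero_or_eq : ∀ p ∈ H, p * p = p → e * p = p → p * e = p → p = 0 ∨ p = e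

/-- Fitting's lemma: primitive idempotents are local if the elements of `H` are strongly
`π`-regular. -/
theorem IsPrimitiveIdem.isLocalIdem {e : R} (he : IsPrimitiveIdem H e)
    (hreg : ∀ c ∈ H, ∃ n : ℕ, ∃ d ∈ H, ∃ d',
      d * (c ^ (n + 1) * c ^ (n + 1)) = c ^ (n + 1) ∧
      (c ^ (n + 1) * c ^ (n + 1)) * d' = c ^ (n + 1)) : IsLocalIdem H e where
  mem := he.mem
  idem := he.idem
  ne_zero := he.ne_zero
  nilpotent_or_unit c hc hec hce := by
    obtain ⟨n, d, hd, d', h1, h2⟩ := hreg c hc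
    set x := c ^ (n + 1) with hx
    have hxe : x * e = x := by rw [hx, pow_succ, mul_assoc, hce]
    have hex : e * x = x := by rw [hx, pow_succ', ← mul_assoc, hec]
    -- The two descriptions place this element in `eRe` and make it idempotent, so it is `0` or `e`:
    -- in the first case `x = 0`, in the second `c` is invertible.
    have hp : d * x = x * d' := by
      calc d * x = d * (x * x * d') := by rw [h2]
        _ = d * (x * x) * d' := by simp only [mul_assoc]
        _ = x * d' := by rw [h1]
    have hpx : d * x * x = x := by rw [mul_assoc, h1]
    rcases he.eq_zero_or_eq (d * x) (H.mul_mem hd (H.pow_mem hc _))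
      (by nth_rw 2 [hp]; rw [← mul_assoc, hpx, hp])
      (by rw [hp, ← mul_assoc, hex]) (by rw [mul_assoc, hxe]) with h0 | h0
    · exact .inl ⟨n + 1, by rw [← hx, ← hpx, h0, zero_mul]⟩
    · right
      have hl : e * d * c ^ n * e * c = e := by
        calc e * d * c ^ n * e * c = e * (d * (c ^ n * c)) := by
              simp only [mul_assoc]; rw [hec]
          _ = e := by rw [← pow_succ, ← hx, h0, he.idem]
      have hr : c * (e * c ^ n * d' * e) = e := by
        calc c * (e * c ^ n * d' * e) = (c * e) * c ^ n * d' * e := by simp only [mul_assoc]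
          _ = e := by rw [hce, ← pow_succ', ← hx, ← hp, h0, he.idem]
      have hlr : e * d * c ^ n * e = e * c ^ n * d' * e := by
        calc e * d * c ^ n * e = e * d * c ^ n * e * e := by rw [mul_assoc _ e e, he.idem]
          _ = e * d * c ^ n * e * (c * (e * c ^ n * d' * e)) := by rw [hr]
          _ = e * d * c ^ n * e * c * (e * c ^ n * d' * e) := by simp only [mul_assoc]
          _ = e * (e * c ^ n * d' * e) := by rw [hl]
          _ = (e * e) * c ^ n * d' * e := by simp only [mul_assoc]
          _ = e * c ^ n * d' * e := by rw [he.idem]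
      refine ⟨e * d * c ^ n * e,
        H.mul_mem (H.mul_mem (H.mul_mem he.mem hd) (H.pow_mem hc _)) he.mem, ?_, ?_, ?_, hl⟩
      · simp only [← mul_assoc]; rw [he.idem]
      · rw [mul_assoc, he.idem]
      · rw [hlr, hr]

end Fitting

end GradedQF

namespace GradedQF

open DirectSum

/-! ### Graded submodules: lattice, minimal elements, socles -/

section GradedSubmodules

variable {G : Type v} [DecidableEq G] {A : Type*} [Ring A]
  {M : Type*} [AddCommGroup M] [Module A M]
  (ℳ : G → AddSubgroup M) [DirectSum.Decomposition ℳ]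

variable {ℳ}

theorem isHomogeneous_bot : (⊥ : Submodule A M).IsHomogeneous ℳ := by
  intro i m hm
  rw [(Submodule.mem_bot A).1 hm, decompose_zero]
  exact Submodule.zero_mem _

theorem isHomogeneous_top : (⊤ : Submodule A M).IsHomogeneous ℳ :=
  fun _ _ _ => Submodule.mem_top

theorem isHomogeneous_inf {N N' : Submodule A M} (hN : N.IsHomogeneous ℳ)
    (hN' : N'.IsHomogeneous ℳ) : (N ⊓ N').IsHomogeneous ℳ :=
  fun i _ hm => ⟨hN i hm.1, hN' i hm.2⟩

theorem isHomogeneous_sup {N N' : Submodule A M} (hN : N.IsHomogeneous ℳ)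
    (hN' : N'.IsHomogeneous ℳ) : (N ⊔ N').IsHomogeneous ℳ := by
  intro i m hm
  obtain ⟨x, hx, y, hy, rfl⟩ := Submodule.mem_sup.1 hm
  rw [decompose_add]
  exact Submodule.add_mem_sup (hN i hx) (hN' i hy)

theorem isHomogeneous_iSup {ι : Sort*} {N : ι → Submodule A M}
    (hN : ∀ j, (N j).IsHomogeneous ℳ) : (⨆ j, N j).IsHomogeneous ℳ := by
  intro i m hm
  induction hm using Submodule.iSup_induction' with
  | mem j x hx => exact Submodule.mem_iSup_of_mem j (hN j i hx)
  | zero => rw [decompose_zero]; exact Submodule.zero_mem _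
  | add x y _ _ hx hy => rw [decompose_add]; exact Submodule.add_mem _ hx hy

theorem le_of_forall_homogeneous {N N' : Submodule A M} (hN : N.IsHomogeneous ℳ)
    (h : ∀ i, ∀ x ∈ ℳ i, x ∈ N → x ∈ N') : N ≤ N' := by
  classical
  intro x hx
  rw [← sum_support_decompose ℳ x]
  exact Submodule.sum_mem _ fun i _ => h i _ (SetLike.coe_mem _) (hN i hx)

theorem exists_homogeneous_of_not_le {N N' : Submodule A M} (hN : N.IsHomogeneous ℳ)
    (h : ¬ N ≤ N') : ∃ i, ∃ x ∈ ℳ i, x ∈ N ∧ x ∉ N' := by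
  by_contra! h'
  exact h (le_of_forall_homogeneous hN h')

theorem exists_homogeneous_ne_zero {N : Submodule A M} (hN : N.IsHomogeneous ℳ) (h : N ≠ ⊥) :
    ∃ i, ∃ x ∈ ℳ i, x ∈ N ∧ x ≠ 0 := by
  obtain ⟨i, x, hx, hxN, hx0⟩ := exists_homogeneous_of_not_le hN (mt le_bot_iff.1 h)
  exact ⟨i, x, hx, hxN, fun h0 => hx0 (h0 ▸ Submodule.zero_mem _)⟩

variable (A ℳ) in
/-- The lattice of graded submodules. -/
def gradedSublattice : Sublattice (Submodule A M) where
  carrier := {N | N.IsHomogeneous ℳ}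
  supClosed' _ hN _ hN' := isHomogeneous_sup hN hN'
  infClosed' _ hN _ hN' := isHomogeneous_inf hN hN'

instance : BoundedOrder (gradedSublattice A ℳ) where
  top := ⟨⊤, isHomogeneous_top⟩
  le_top N := le_top (a := N.1)
  bot := ⟨⊥, isHomogeneous_bot⟩
  bot_le N := bot_le (a := N.1)

instance : IsModularLattice (gradedSublattice A ℳ) where
  sup_inf_le_assoc_of_le {x} y {z} hxz :=
    IsModularLattice.sup_inf_le_assoc_of_le (x := x.1) y.1 (z := z.1) hxz

theorem eq_or_eq_of_wcovBy {U V : gradedSublattice A ℳ} (h : U ⩿ V) {K : Submodule A M}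
    (hK : K.IsHomogeneous ℳ) (hUK : U.1 ≤ K) (hKV : K ≤ V.1) : K = U.1 ∨ K = V.1 :=
  (h.eq_or_eq (c := ⟨K, hK⟩) hUK hKV).imp (congrArg Subtype.val) (congrArg Subtype.val)

theorem IsGradedArtinianModule.wellFoundedLT (h : IsGradedArtinianModule A ℳ) :
    WellFoundedLT (gradedSublattice A ℳ) := h

theorem IsGradedArtinianModule.exists_minimal (h : IsGradedArtinianModule A ℳ)
    {p : Submodule A M → Prop} (hp : ∃ N : Submodule A M, N.IsHomogeneous ℳ ∧ p N) :
    ∃ N : Submodule A M, N.IsHomogeneous ℳ ∧ p N ∧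
      ∀ N' : Submodule A M, N'.IsHomogeneous ℳ → p N' → N' ≤ N → N' = N := by
  obtain ⟨N, hN, hpN⟩ := hp
  obtain ⟨⟨K, hK⟩, hpK, hmin⟩ := h.wf.has_min
    {N : {N : Submodule A M // N.IsHomogeneous ℳ} | p N.1} ⟨⟨N, hN⟩, hpN⟩
  refine ⟨K, hK, hpK, fun N' hN' hpN' hle => ?_⟩
  by_contra hne
  exact hmin ⟨N', hN'⟩ hpN' (lt_of_le_of_ne hle fun h => hne (congrArg Subtype.val h))

theorem IsGradedArtinianModule.exists_stable (h : IsGradedArtinianModule A ℳ)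
    {f : ℕ → Submodule A M} (hf : Antitone f) (hhom : ∀ n, (f n).IsHomogeneous ℳ) :
    ∃ n, ∀ m, n ≤ m → f m = f n := by
  obtain ⟨-, -, ⟨n, rfl⟩, hmin⟩ := h.exists_minimal (p := fun N => ∃ n, f n = N) ⟨_, hhom 0, 0, rfl⟩
  exact ⟨n, fun m hm => hmin _ (hhom m) ⟨m, rfl⟩ (hf hm)⟩

theorem IsGradedArtinianModule.exists_isGradedSimpleSubmodule (h : IsGradedArtinianModule A ℳ)
    {P : Submodule A M} (hP : P.IsHomogeneous ℳ) (hne : P ≠ ⊥) :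
    ∃ N ≤ P, IsGradedSimpleSubmodule ℳ N := by
  obtain ⟨N, hN, ⟨hNP, hN0⟩, hmin⟩ :=
    h.exists_minimal (p := fun N => N ≤ P ∧ N ≠ ⊥) ⟨P, hP, le_rfl, hne⟩
  refine ⟨N, hNP, hN, hN0, fun N' hN' hle => ?_⟩
  by_cases h0 : N' = ⊥
  · exact .inl h0
  · exact .inr (hmin N' hN' ⟨hle.trans hNP, h0⟩ hle)

/-- Existence comes from the chain condition. If non-zero graded submodules of `P` always meet, two
simple ones both equal their intersection. -/
theorem IsGradedArtinianModule.existsUnique_isGradedSimpleSubmodule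
    (h : IsGradedArtinianModule A ℳ) {P : Submodule A M} (hP : P.IsHomogeneous ℳ) (hne : P ≠ ⊥)
    (hess : ∀ N N' : Submodule A M, N.IsHomogeneous ℳ → N'.IsHomogeneous ℳ → N ≤ P → N' ≤ P →
      N ⊓ N' = ⊥ → N = ⊥ ∨ N' = ⊥) :
    ∃! N : Submodule A M, N ≤ P ∧ IsGradedSimpleSubmodule ℳ N := by
  obtain ⟨N, hNP, hN⟩ := h.exists_isGradedSimpleSubmodule hP hne
  refine ⟨N, ⟨hNP, hN⟩, ?_⟩
  rintro N' ⟨hNP', hN'⟩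
  have hinf := isHomogeneous_inf hN'.1 hN.1
  have hne' : N' ⊓ N ≠ ⊥ := fun h0 =>
    (hess N' N hN'.1 hN.1 hNP' hNP h0).elim hN'.2.1 hN.2.1
  exact ((hN'.2.2 _ hinf inf_le_left).resolve_left hne').symm.trans
    ((hN.2.2 _ hinf inf_le_right).resolve_left hne')

/-- If `P` has a unique graded simple submodule, that submodule has a homogeneous generator
contained in all cyclic submodules generated by non-zero homogeneous elements of `P`. -/
theorem IsGradedArtinianModule.exists_socle_generator (h : IsGradedArtinianModule A ℳ)
    (hspan : ∀ i, ∀ x ∈ ℳ i, (Submodule.span A {x}).IsHomogeneous ℳ) {P : Submodule A M}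
    (huniq : ∃! N : Submodule A M, N ≤ P ∧ IsGradedSimpleSubmodule ℳ N) :
    ∃ i, ∃ s ∈ ℳ i, s ≠ 0 ∧ s ∈ P ∧
      ∀ j, ∀ x ∈ ℳ j, x ≠ 0 → x ∈ P → s ∈ Submodule.span A {x} := by
  obtain ⟨N, ⟨hNP, hN⟩, hN'⟩ := huniq
  obtain ⟨i, s, hs, hsN, hs0⟩ := exists_homogeneous_ne_zero hN.1 hN.2.1
  refine ⟨i, s, hs, hs0, hNP hsN, fun j x hx hx0 hxP => ?_⟩
  obtain ⟨K, hKx, hK⟩ := h.exists_isGradedSimpleSubmodule (hspan j x hx)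
    (mt Submodule.span_singleton_eq_bot.1 hx0)
  have hKP : K ≤ P := hKx.trans ((Submodule.span_singleton_le_iff_mem _ _).2 hxP)
  rw [← hN' K ⟨hKP, hK⟩] at hsN
  exact hKx hsN

/-- Zorn's lemma applies because avoiding one element survives unions of chains; no ascending chain
condition is needed. -/
theorem exists_maximal_homogeneous {N : Submodule A M} (hN : N.IsHomogeneous ℳ) {x : M}
    (hx : x ∉ N) : ∃ K : Submodule A M, K.IsHomogeneous ℳ ∧ N ≤ K ∧ x ∉ K ∧
      ∀ K' : Submodule A M, K'.IsHomogeneous ℳ → K ≤ K' → x ∉ K' → K' = K := by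
  obtain ⟨K, hNK, hK⟩ := zorn_le_nonempty₀
    {K : Submodule A M | K.IsHomogeneous ℳ ∧ x ∉ K} (fun c hc hchain y hy => by
      refine ⟨sSup c, ⟨?_, fun hxc => ?_⟩, fun z hz => le_sSup hz⟩
      · rw [sSup_eq_iSup']
        exact isHomogeneous_iSup fun j => (hc j.2).1
      · obtain ⟨z, hz, hxz⟩ := (Submodule.mem_sSup_of_directed ⟨y, hy⟩ hchain.directedOn).1 hxc
        exact (hc hz).2 hxz) N ⟨hN, hx⟩
  exact ⟨K, hK.prop.1, hNK, hK.prop.2, fun K' hK' hle hxK' =>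
    (hK.le_of_ge ⟨hK', hxK'⟩ hle).antisymm hle⟩

/-! ### Gradings on quotients -/

section Quotient

/-- The grading of the quotient of a graded module by a submodule. -/
def quotientGrading {G A M : Type*} [Ring A] [AddCommGroup M] [Module A M]
    (ℳ : G → AddSubgroup M) (N : Submodule A M) : G → AddSubgroup (M ⧸ N) :=
  fun g => (ℳ g).map N.mkQ.toAddMonoidHom

theorem mk_mem_quotientGrading {G A M : Type*} [Ring A] [AddCommGroup M] [Module A M]
    {ℳ : G → AddSubgroup M} (N : Submodule A M) {g : G} {x : M} (hx : x ∈ ℳ g) :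
    N.mkQ x ∈ quotientGrading ℳ N g :=
  ⟨x, hx, rfl⟩

variable (ℳ)

/-- The homogeneous components of the image in `M ⧸ N` of an element of `M`. -/
noncomputable def quotientComponents (N : Submodule A M) :
    M →+ ⨁ g, quotientGrading ℳ N g :=
  (DirectSum.map fun g => N.mkQ.toAddMonoidHom.addSubgroupMap (ℳ g)).comp
    (decomposeAddEquiv ℳ).toAddMonoidHom

theorem quotientComponents_apply (N : Submodule A M) (x : M) (g : G) :
    (quotientComponents ℳ N x g : M ⧸ N) = N.mkQ (decompose ℳ x g) :=
  rfl

theorem coe_quotientComponents (N : Submodule A M) (x : M) :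
    DirectSum.coeAddMonoidHom (quotientGrading ℳ N) (quotientComponents ℳ N x) = N.mkQ x := by
  induction x using Decomposition.inductionOn ℳ with
  | zero => simp
  | @homogeneous i m =>
    have : quotientComponents ℳ N (m : M) =
        DirectSum.of (fun g => quotientGrading ℳ N g) i
          (N.mkQ.toAddMonoidHom.addSubgroupMap (ℳ i) m) := by
      change DirectSum.map _ (decompose ℳ (m : M)) = _
      rw [decompose_coe, DirectSum.map_of]
      rfl
    rw [this]
    exact DirectSum.coeAddMonoidHom_of (quotientGrading ℳ N) i _
  | add x y hx hy => rw [map_add, map_add, map_add, hx, hy]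

theorem quotientComponents_surjective (N : Submodule A M) :
    Function.Surjective (quotientComponents ℳ N) :=
  ((DirectSum.map_surjective _).2 fun _ =>
    AddMonoidHom.addSubgroupMap_surjective _ _).comp (decomposeAddEquiv ℳ).surjective

variable {ℳ}

theorem isInternal_quotientGrading {N : Submodule A M} (hN : N.IsHomogeneous ℳ) :
    DirectSum.IsInternal (quotientGrading ℳ N) := by
  constructor
  · refine (injective_iff_map_eq_zero _).2 fun z hz => ?_
    obtain ⟨x, rfl⟩ := quotientComponents_surjective ℳ N z
    rw [coe_quotientComponents] at hz
    have hx : x ∈ N := (Submodule.Quotient.mk_eq_zero N).1 hz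
    refine DFinsupp.ext fun i => Subtype.ext ?_
    exact (Submodule.Quotient.mk_eq_zero N).2 (hN i hx)
  · intro y
    obtain ⟨x, rfl⟩ := N.mkQ_surjective y
    exact ⟨_, coe_quotientComponents ℳ N x⟩

/-- The quotient of a graded module by a graded submodule is graded. -/
noncomputable abbrev quotientDecomposition {N : Submodule A M} (hN : N.IsHomogeneous ℳ) :
    DirectSum.Decomposition (quotientGrading ℳ N) :=
  (isInternal_quotientGrading hN).chooseDecomposition

theorem decompose_mkQ {N : Submodule A M} [DirectSum.Decomposition (quotientGrading ℳ N)]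
    (x : M) (g : G) :
    (decompose (quotientGrading ℳ N) (N.mkQ x) g : M ⧸ N) = N.mkQ (decompose ℳ x g) := by
  have : decompose (quotientGrading ℳ N) (N.mkQ x) = quotientComponents ℳ N x :=
    (decompose _).symm.injective (by
      rw [Equiv.symm_apply_apply]
      exact (coe_quotientComponents ℳ N x).symm)
  rw [this, quotientComponents_apply]

/-- Pull a graded submodule of the quotient back to `M`: if it contains the generator `x` it is
everything, otherwise maximality makes it `N`. -/
theorem isGradedSimple_quotient {N : Submodule A M} (hN : N.IsHomogeneous ℳ) {x : M}
    (hx : x ∉ N) (hgen : ∀ K : Submodule A M, x ∈ K → K = ⊤)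
    (hmax : ∀ K : Submodule A M, K.IsHomogeneous ℳ → N ≤ K → x ∉ K → K = N) :
    letI := quotientDecomposition hN
    IsGradedSimple A (quotientGrading ℳ N) := by
  let _ := quotientDecomposition hN
  refine ⟨⟨⟨N.mkQ x, 0, fun h => hx ((Submodule.Quotient.mk_eq_zero N).1 h)⟩⟩, fun K hK => ?_⟩
  have hhom : (K.comap N.mkQ).IsHomogeneous ℳ := by
    intro i m hm
    have := hK i (m := N.mkQ m) hm
    rwa [decompose_mkQ] at this
  have hle : N ≤ K.comap N.mkQ := by
    intro y hy
    rw [Submodule.mem_comap, N.mkQ_apply, (Submodule.Quotient.mk_eq_zero N).2 hy]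
    exact K.zero_mem
  by_cases hxK : x ∈ K.comap N.mkQ
  · right
    rw [← Submodule.map_comap_eq_of_surjective N.mkQ_surjective K, hgen _ hxK, Submodule.map_top,
      N.range_mkQ]
  · left
    rw [← Submodule.map_comap_eq_of_surjective N.mkQ_surjective K, hmax _ hhom hle hxK]
    exact N.mkQ_map_self

end Quotient

end GradedSubmodules

end GradedQF

namespace GradedQF

open DirectSum MulOpposite

/-! ### Linear maps that change degrees -/

section DegreeShift

variable {G : Type v} [DecidableEq G] {M N : Type*} [AddCommGroup M] [AddCommGroup N]
  (ℳ : G → AddSubgroup M) [DirectSum.Decomposition ℳ]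
  (𝒩 : G → AddSubgroup N) [DirectSum.Decomposition 𝒩]

/-- Injectivity of `δ` keeps different components from landing in one degree. A general `δ` covers
left and right translations of `G` together. -/
theorem decompose_map_of_shift (φ : M →+ N) {δ : G → G} (hδ : Function.Injective δ)
    (hφ : ∀ g, ∀ x ∈ ℳ g, φ x ∈ 𝒩 (δ g)) (x : M) (g : G) :
    (decompose 𝒩 (φ x) (δ g) : N) = φ (decompose ℳ x g) := by
  induction x using Decomposition.inductionOn ℳ with
  | zero => simp
  | @homogeneous i m =>
    by_cases h : i = g
    · subst h
      rw [decompose_of_mem_same _ (hφ i _ m.2), decompose_of_mem_same _ m.2]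
    · rw [decompose_of_mem_ne _ (hφ i _ m.2) fun h' => h (hδ h'), decompose_of_mem_ne _ m.2 h,
        map_zero]
  | add x y hx hy =>
    simp only [map_add, decompose_add, DirectSum.add_apply, AddSubgroup.coe_add, hx, hy]

variable {A : Type*} [Ring A] [Module A M] [Module A N]

variable {ℳ 𝒩} in
theorem isHomogeneous_ker (φ : M →ₗ[A] N) {δ : G → G} (hδ : Function.Injective δ)
    (hφ : ∀ g, ∀ x ∈ ℳ g, φ x ∈ 𝒩 (δ g)) : (LinearMap.ker φ).IsHomogeneous ℳ := by
  intro i m hm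
  have h := decompose_map_of_shift ℳ 𝒩 φ.toAddMonoidHom hδ hφ m i
  rw [LinearMap.mem_ker] at hm ⊢
  change _ = φ _ at h
  rw [← h]
  change ((decompose 𝒩 (φ m)) (δ i) : N) = 0
  rw [hm, decompose_zero]
  rfl

variable {ℳ 𝒩} in
theorem isHomogeneous_range (φ : M →ₗ[A] N) (δ : G ≃ G)
    (hφ : ∀ g, ∀ x ∈ ℳ g, φ x ∈ 𝒩 (δ g)) : (LinearMap.range φ).IsHomogeneous 𝒩 := by
  rintro i - ⟨m, rfl⟩
  obtain ⟨i, rfl⟩ := δ.surjective i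
  have h := decompose_map_of_shift ℳ 𝒩 φ.toAddMonoidHom δ.injective hφ m i
  exact ⟨_, h.symm⟩

variable {ℳ 𝒩} in
/-- A graded simple quotient of `M` embeds into the target of every non-zero homogeneous map which
vanishes on the kernel of the projection. -/
theorem exists_injective_of_isGradedSimple {S : Type*} [AddCommGroup S] [Module A S]
    {𝒮 : G → AddSubgroup S} [DirectSum.Decomposition 𝒮] (hS : IsGradedSimple A 𝒮)
    {φ : M →ₗ[A] S} {ψ : M →ₗ[A] N} {δ ε : G ≃ G} (hφ : ∀ g, ∀ x ∈ ℳ g, φ x ∈ 𝒮 (δ g))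
    (hψ : ∀ g, ∀ x ∈ ℳ g, ψ x ∈ 𝒩 (ε g)) (hφ0 : φ ≠ 0) (hψ0 : ψ ≠ 0)
    (hker : LinearMap.ker φ ≤ LinearMap.ker ψ) :
    ∃ f : S →ₗ[A] N, Function.Injective f ∧ ∀ g, ∀ x ∈ 𝒮 (δ g), f x ∈ 𝒩 (ε g) := by
  have hsurj : Function.Surjective φ := LinearMap.range_eq_top.1
    ((hS.2 _ (isHomogeneous_range φ δ hφ)).resolve_left fun h => hφ0 (LinearMap.range_eq_bot.1 h))
  let f : S →ₗ[A] N := ((LinearMap.ker φ).liftQ ψ hker).comp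
    (φ.quotKerEquivOfSurjective hsurj).symm.toLinearMap
  have hf : ∀ m, f (φ m) = ψ m := by
    intro m
    have : (φ.quotKerEquivOfSurjective hsurj).symm (φ m) = (LinearMap.ker φ).mkQ m := by
      rw [LinearEquiv.symm_apply_eq]
      rfl
    simp only [f, LinearMap.comp_apply, LinearEquiv.coe_coe, this]
    rfl
  have hdeg : ∀ g, ∀ x ∈ 𝒮 (δ g), f x ∈ 𝒩 (ε g) := by
    intro g x hx
    obtain ⟨m, rfl⟩ := hsurj x
    have h := decompose_map_of_shift ℳ 𝒮 φ.toAddMonoidHom δ.injective hφ m g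
    have h' : φ m = φ (decompose ℳ m g) := (decompose_of_mem_same _ hx).symm.trans h
    rw [h', hf]
    exact hψ g _ (SetLike.coe_mem _)
  refine ⟨f, ?_, hdeg⟩
  -- `f` moves degrees by `δ⁻¹` followed by `ε`; its kernel is therefore graded, and simplicity of
  -- `S` leaves only injectivity, as `ψ ≠ 0`.
  have hkf : (LinearMap.ker f).IsHomogeneous 𝒮 :=
    isHomogeneous_ker f (δ := δ.symm.trans ε) (δ.symm.trans ε).injective fun g x hx =>
      hdeg (δ.symm g) x (by rwa [Equiv.apply_symm_apply])
  refine LinearMap.ker_eq_bot.1 ((hS.2 _ hkf).resolve_right fun h => hψ0 ?_)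
  ext m
  rw [← hf, LinearMap.ker_eq_top.1 h]
  rfl

end DegreeShift

section Factors

variable {G : Type v} [DecidableEq G] {A : Type*} [Ring A]
  {M : Type*} [AddCommGroup M] [Module A M]
  {ℳ : G → AddSubgroup M} [DirectSum.Decomposition ℳ]

theorem IsGradedIndecomposableFactor.exists_isCompl {P : Submodule A M}
    (hP : IsGradedIndecomposableFactor ℳ P) :
    IsGradedIndecomposableSubmodule ℳ P ∧
      ∃ P' : Submodule A M, P'.IsHomogeneous ℳ ∧ IsCompl P P' := by
  obtain ⟨n, Q, hQ, hint, i, rfl⟩ := hP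
  refine ⟨hQ i, ⨆ j, ⨆ _ : j ≠ i, Q j,
    isHomogeneous_iSup fun j => isHomogeneous_iSup fun _ => (hQ j).1,
    hint.submodule_iSupIndep i, ?_⟩
  rw [codisjoint_iff_le_sup, ← hint.submodule_iSup_eq_top]
  refine iSup_le fun j => ?_
  by_cases h : j = i
  · rw [h]; exact le_sup_left
  · exact le_sup_of_le_right (le_iSup₂_of_le j h le_rfl)

end Factors

/-! ### Homogeneous idempotents and principal indecomposable modules -/

section GradedRings

variable {G : Type v} [AddGroup G] [DecidableEq G] {R : Type u} [Ring R]
  (𝒜 : G → AddSubgroup R) [GradedRing 𝒜]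

/-- Only the component of `a` in degree `j - i` contributes to the degree `j` part of `a * x`. -/
theorem leftDivisionClosed_homogeneousSubmonoid :
    LeftDivisionClosed (SetLike.homogeneousSubmonoid 𝒜) := by
  rintro x ⟨i, hx⟩ z ⟨j, hz⟩ a rfl
  refine ⟨decompose 𝒜 a (j - i), ⟨_, SetLike.coe_mem _⟩, ?_⟩
  rw [← coe_decompose_mul_add_of_right_mem 𝒜 hx, sub_add_cancel, decompose_of_mem_same 𝒜 hz]

theorem rightDivisionClosed_homogeneousSubmonoid :
    RightDivisionClosed (SetLike.homogeneousSubmonoid 𝒜) := by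
  rintro x ⟨i, hx⟩ z ⟨j, hz⟩ a rfl
  refine ⟨decompose 𝒜 a (-i + j), ⟨_, SetLike.coe_mem _⟩, ?_⟩
  rw [← coe_decompose_mul_add_of_left_mem 𝒜 hx, add_neg_cancel_left, decompose_of_mem_same 𝒜 hz]

variable {𝒜}

theorem mem_span_left_iff {x y : R} : y ∈ Submodule.span R {x} ↔ ∃ a, a * x = y :=
  Submodule.mem_span_singleton

theorem mem_span_right_iff {x y : R} : y ∈ Submodule.span Rᵐᵒᵖ {x} ↔ ∃ a, x * a = y := by
  rw [Submodule.mem_span_singleton]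
  exact ⟨fun ⟨a, h⟩ => ⟨a.unop, h⟩, fun ⟨a, h⟩ => ⟨op a, h⟩⟩

theorem mem_span_left_idem_iff {e x : R} (he : e * e = e) :
    x ∈ Submodule.span R {e} ↔ x * e = x := by
  rw [mem_span_left_iff]
  refine ⟨?_, fun h => ⟨x, h⟩⟩
  rintro ⟨a, rfl⟩
  rw [mul_assoc, he]

theorem mem_span_right_idem_iff {e x : R} (he : e * e = e) :
    x ∈ Submodule.span Rᵐᵒᵖ {e} ↔ e * x = x := by
  rw [mem_span_right_iff]
  refine ⟨?_, fun h => ⟨x, h⟩⟩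
  rintro ⟨a, rfl⟩
  rw [← mul_assoc, he]

theorem isHomogeneous_span_left (i : G) (x : R) (hx : x ∈ 𝒜 i) :
    (Submodule.span R {x}).IsHomogeneous 𝒜 := by
  intro j y hy
  obtain ⟨a, rfl⟩ := mem_span_left_iff.1 hy
  refine mem_span_left_iff.2 ⟨decompose 𝒜 a (j - i), ?_⟩
  rw [← coe_decompose_mul_add_of_right_mem 𝒜 hx, sub_add_cancel]

theorem isHomogeneous_span_right (i : G) (x : R) (hx : x ∈ 𝒜 i) :
    (Submodule.span Rᵐᵒᵖ {x}).IsHomogeneous 𝒜 := by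
  intro j y hy
  obtain ⟨a, rfl⟩ := mem_span_right_iff.1 hy
  refine mem_span_right_iff.2 ⟨decompose 𝒜 a (-i + j), ?_⟩
  rw [← coe_decompose_mul_add_of_left_mem 𝒜 hx, add_neg_cancel_left]

theorem mem_zero_of_idem {p : R} (hp : p ∈ SetLike.homogeneousSubmonoid 𝒜) (h : p * p = p) :
    p ∈ 𝒜 0 := by
  obtain ⟨g, hg⟩ := hp
  by_cases h0 : p = 0
  · rw [h0]; exact (𝒜 0).zero_mem
  have hgg : p ∈ 𝒜 (g + g) := by
    rw [← h]; exact SetLike.GradedMul.mul_mem hg hg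
  have := degree_eq_of_mem_mem 𝒜 hg hgg h0
  rw [left_eq_add] at this
  rwa [this] at hg

/-- The chains of left and right ideals generated by powers of `c` both stabilise; an exponent
beyond both thresholds works. This is the strong `π`-regularity used in Fitting's lemma. -/
theorem IsGradedArtinian.exists_pow (hR : IsGradedArtinian 𝒜) {c : R}
    (hc : c ∈ SetLike.homogeneousSubmonoid 𝒜) :
    ∃ n : ℕ, ∃ d ∈ SetLike.homogeneousSubmonoid 𝒜, ∃ d',
      d * (c ^ (n + 1) * c ^ (n + 1)) = c ^ (n + 1) ∧
      (c ^ (n + 1) * c ^ (n + 1)) * d' = c ^ (n + 1) := by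
  have hpow : ∀ n, c ^ n ∈ SetLike.homogeneousSubmonoid 𝒜 := fun n =>
    (SetLike.homogeneousSubmonoid 𝒜).pow_mem hc n
  obtain ⟨n₁, h₁⟩ := hR.1.exists_stable (f := fun n => Submodule.span R {c ^ (n + 1)})
    (antitone_nat_of_succ_le fun n => (Submodule.span_singleton_le_iff_mem _ _).2
      (mem_span_left_iff.2 ⟨c, (pow_succ' _ _).symm⟩))
    (fun n => by obtain ⟨i, hi⟩ := hpow (n + 1); exact isHomogeneous_span_left i _ hi)
  obtain ⟨n₂, h₂⟩ := hR.2.exists_stable (f := fun n => Submodule.span Rᵐᵒᵖ {c ^ (n + 1)})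
    (antitone_nat_of_succ_le fun n => (Submodule.span_singleton_le_iff_mem _ _).2
      (mem_span_right_iff.2 ⟨c, (pow_succ _ _).symm⟩))
    (fun n => by obtain ⟨i, hi⟩ := hpow (n + 1); exact isHomogeneous_span_right i _ hi)
  set n := max n₁ n₂
  have e : c ^ (n + 1) * c ^ (n + 1) = c ^ (n + 1 + n + 1) := by rw [← pow_add, ← add_assoc]
  have h₁' : c ^ (n + 1) ∈ Submodule.span R {c ^ (n + 1 + n + 1)} := by
    rw [(h₁ (n + 1 + n) (by omega)).trans (h₁ n (le_max_left _ _)).symm]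
    exact Submodule.mem_span_singleton_self _
  have h₂' : c ^ (n + 1) ∈ Submodule.span Rᵐᵒᵖ {c ^ (n + 1 + n + 1)} := by
    rw [(h₂ (n + 1 + n) (by omega)).trans (h₂ n (le_max_right _ _)).symm]
    exact Submodule.mem_span_singleton_self _
  rw [← e] at h₁' h₂'
  obtain ⟨d, hd⟩ := mem_span_left_iff.1 h₁'
  obtain ⟨d, hdH, hd⟩ := leftDivisionClosed_homogeneousSubmonoid 𝒜 _
    (Submonoid.mul_mem _ (hpow _) (hpow _)) _ (hpow _) d hd
  obtain ⟨d', hd'⟩ := mem_span_right_iff.1 h₂'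
  exact ⟨n, d, hdH, d', hd, hd'⟩

theorem IsGradedArtinian.isLocalIdem (hR : IsGradedArtinian 𝒜) {e : R}
    (he : IsPrimitiveIdem (SetLike.homogeneousSubmonoid 𝒜) e) :
    IsLocalIdem (SetLike.homogeneousSubmonoid 𝒜) e :=
  he.isLocalIdem fun _ hc => hR.exists_pow hc

/-- Principal graded indecomposable left modules are generated by primitive idempotents. -/
theorem exists_isPrimitiveIdem_left {P : Submodule R R} (hP : IsGradedIndecomposableFactor 𝒜 P) :
    ∃ e, IsPrimitiveIdem (SetLike.homogeneousSubmonoid 𝒜) e ∧ P = Submodule.span R {e} := by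
  obtain ⟨⟨hhom, hne, hind⟩, P', hP', hcompl⟩ := hP.exists_isCompl
  obtain ⟨e, he, f, hf, hef⟩ :=
    Submodule.mem_sup.1 (hcompl.sup_eq_top ▸ Submodule.mem_top : (1 : R) ∈ P ⊔ P')
  -- Since `1` has degree zero, degree-zero components again sum to `1`, and they stay in the graded
  -- summands `P` and `P'`.
  have hef0 : (decompose 𝒜 e 0 : R) + decompose 𝒜 f 0 = 1 := by
    rw [← AddSubgroup.coe_add, ← DirectSum.add_apply, ← decompose_add, hef,
      decompose_of_mem_same 𝒜 SetLike.GradedOne.one_mem]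
  replace he := hhom 0 he
  replace hf := hP' 0 hf
  have he0 : (decompose 𝒜 e 0 : R) ∈ 𝒜 0 := SetLike.coe_mem _
  generalize (decompose 𝒜 e 0 : R) = e at *
  generalize (decompose 𝒜 f 0 : R) = f at *
  have hxe : ∀ x ∈ P, x * e = x := by
    intro x hx
    have hsum : x * e + x * f = x := by rw [← mul_add, hef0, mul_one]
    have hxf : x * f ∈ P ⊓ P' := by
      refine ⟨?_, P'.smul_mem x hf⟩
      rw [eq_sub_of_add_eq' hsum]
      exact P.sub_mem hx (P.smul_mem x he)
    rw [hcompl.inf_eq_bot, Submodule.mem_bot] at hxf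
    rwa [hxf, add_zero] at hsum
  have hPe : P = Submodule.span R {e} :=
    le_antisymm (fun x hx => mem_span_left_iff.2 ⟨x, hxe x hx⟩)
      ((Submodule.span_singleton_le_iff_mem _ _).2 he)
  have hee := hxe e he
  refine ⟨e, ⟨⟨0, he0⟩, hee, fun h0 => hne ?_, fun p hp hpp hep hpe => ?_⟩, hPe⟩
  · rw [hPe, h0, Submodule.span_singleton_eq_bot]
  have hp0 := mem_zero_of_idem hp hpp
  have hqe : (e - p) * e = e - p := by rw [sub_mul, hee, hpe]
  have hqp : (e - p) * p = 0 := by rw [sub_mul, hep, hpp, sub_self]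
  have hqq : (e - p) * (e - p) = e - p := by rw [mul_sub, hqe, hqp, sub_zero]
  have hsup : Submodule.span R {p} ⊔ Submodule.span R {e - p} = P := by
    rw [hPe]
    refine le_antisymm (sup_le ?_ ?_) ?_ <;> rw [Submodule.span_singleton_le_iff_mem]
    · exact mem_span_left_iff.2 ⟨p, hpe⟩
    · exact mem_span_left_iff.2 ⟨e - p, hqe⟩
    · exact Submodule.mem_sup.2 ⟨p, Submodule.mem_span_singleton_self _, e - p,
        Submodule.mem_span_singleton_self _, add_sub_cancel _ _⟩
  have hinf : Submodule.span R {p} ⊓ Submodule.span R {e - p} = ⊥ := by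
    refine (Submodule.eq_bot_iff _).2 fun x hx => ?_
    have h1 := (mem_span_left_idem_iff hpp).1 hx.1
    have h2 := (mem_span_left_idem_iff hqq).1 hx.2
    rw [← h1, ← h2, mul_assoc, hqp, mul_zero]
  rcases hind _ _ (isHomogeneous_span_left 0 _ hp0)
    (isHomogeneous_span_left 0 _ (sub_mem he0 hp0)) hsup hinf with h | h
  · exact .inl (Submodule.span_singleton_eq_bot.1 h)
  · exact .inr (sub_eq_zero.1 (Submodule.span_singleton_eq_bot.1 h)).symm

/-- Principal graded indecomposable right modules are generated by primitive idempotents. -/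
theorem exists_isPrimitiveIdem_right {P : Submodule Rᵐᵒᵖ R}
    (hP : IsGradedIndecomposableFactor 𝒜 P) :
    ∃ e, IsPrimitiveIdem (SetLike.homogeneousSubmonoid 𝒜) e ∧ P = Submodule.span Rᵐᵒᵖ {e} := by
  obtain ⟨⟨hhom, hne, hind⟩, P', hP', hcompl⟩ := hP.exists_isCompl
  obtain ⟨e, he, f, hf, hef⟩ :=
    Submodule.mem_sup.1 (hcompl.sup_eq_top ▸ Submodule.mem_top : (1 : R) ∈ P ⊔ P')
  have hef0 : (decompose 𝒜 e 0 : R) + decompose 𝒜 f 0 = 1 := by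
    rw [← AddSubgroup.coe_add, ← DirectSum.add_apply, ← decompose_add, hef,
      decompose_of_mem_same 𝒜 SetLike.GradedOne.one_mem]
  replace he := hhom 0 he
  replace hf := hP' 0 hf
  have he0 : (decompose 𝒜 e 0 : R) ∈ 𝒜 0 := SetLike.coe_mem _
  generalize (decompose 𝒜 e 0 : R) = e at *
  generalize (decompose 𝒜 f 0 : R) = f at *
  have hex : ∀ x ∈ P, e * x = x := by
    intro x hx
    have hsum : e * x + f * x = x := by rw [← add_mul, hef0, one_mul]
    have hxf : f * x ∈ P ⊓ P' := by
      refine ⟨?_, P'.smul_mem (op x) hf⟩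
      rw [eq_sub_of_add_eq' hsum]
      exact P.sub_mem hx (P.smul_mem (op x) he)
    rw [hcompl.inf_eq_bot, Submodule.mem_bot] at hxf
    rwa [hxf, add_zero] at hsum
  have hPe : P = Submodule.span Rᵐᵒᵖ {e} :=
    le_antisymm (fun x hx => mem_span_right_iff.2 ⟨x, hex x hx⟩)
      ((Submodule.span_singleton_le_iff_mem _ _).2 he)
  have hee := hex e he
  refine ⟨e, ⟨⟨0, he0⟩, hee, fun h0 => hne ?_, fun p hp hpp hep hpe => ?_⟩, hPe⟩
  · rw [hPe, h0, Submodule.span_singleton_eq_bot]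
  have hp0 := mem_zero_of_idem hp hpp
  have heq : e * (e - p) = e - p := by rw [mul_sub, hee, hep]
  have hpq : p * (e - p) = 0 := by rw [mul_sub, hpe, hpp, sub_self]
  have hqq : (e - p) * (e - p) = e - p := by rw [sub_mul, heq, hpq, sub_zero]
  have hsup : Submodule.span Rᵐᵒᵖ {p} ⊔ Submodule.span Rᵐᵒᵖ {e - p} = P := by
    rw [hPe]
    refine le_antisymm (sup_le ?_ ?_) ?_ <;> rw [Submodule.span_singleton_le_iff_mem]
    · exact mem_span_right_iff.2 ⟨p, hep⟩
    · exact mem_span_right_iff.2 ⟨e - p, heq⟩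
    · exact Submodule.mem_sup.2 ⟨p, Submodule.mem_span_singleton_self _, e - p,
        Submodule.mem_span_singleton_self _, add_sub_cancel _ _⟩
  have hinf : Submodule.span Rᵐᵒᵖ {p} ⊓ Submodule.span Rᵐᵒᵖ {e - p} = ⊥ := by
    refine (Submodule.eq_bot_iff _).2 fun x hx => ?_
    have h1 := (mem_span_right_idem_iff hpp).1 hx.1
    have h2 := (mem_span_right_idem_iff hqq).1 hx.2
    rw [← h1, ← h2, ← mul_assoc, hpq, zero_mul]
  rcases hind _ _ (isHomogeneous_span_right 0 _ hp0)
    (isHomogeneous_span_right 0 _ (sub_mem he0 hp0)) hsup hinf with h | h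
  · exact .inl (Submodule.span_singleton_eq_bot.1 h)
  · exact .inr (sub_eq_zero.1 (Submodule.span_singleton_eq_bot.1 h)).symm

/-- Split `e` along `N ⊕ N'` into degree-zero parts `n` and `n'`. The products `n * n'` and `n' * n`
lie in `N ⊓ N'`, so `n` is an idempotent of `eRe`, and primitivity leaves `0` or `e`. -/
theorem IsPrimitiveIdem.isGradedIndecomposable_left {e : R}
    (he : IsPrimitiveIdem (SetLike.homogeneousSubmonoid 𝒜) e) :
    IsGradedIndecomposableSubmodule 𝒜 (Submodule.span R {e}) := by
  have he0 := mem_zero_of_idem he.mem he.idem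
  refine ⟨isHomogeneous_span_left 0 e he0, mt Submodule.span_singleton_eq_bot.1 he.ne_zero,
    fun N N' hN hN' hsup hinf => ?_⟩
  obtain ⟨n, hn, n', hn', hnn⟩ :=
    Submodule.mem_sup.1 (hsup ▸ Submodule.mem_span_singleton_self e : e ∈ N ⊔ N')
  have hsum : (decompose 𝒜 n 0 : R) + decompose 𝒜 n' 0 = e := by
    rw [← AddSubgroup.coe_add, ← DirectSum.add_apply, ← decompose_add, hnn,
      decompose_of_mem_same 𝒜 he0]
  replace hn := hN 0 hn
  replace hn' := hN' 0 hn'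
  have hn0 : (decompose 𝒜 n 0 : R) ∈ 𝒜 0 := SetLike.coe_mem _
  generalize (decompose 𝒜 n 0 : R) = n at *
  generalize (decompose 𝒜 n' 0 : R) = n' at *
  have hne : n * e = n :=
    (mem_span_left_idem_iff he.idem).1 (hsup.le (Submodule.mem_sup_left hn))
  have hne' : n' * e = n' :=
    (mem_span_left_idem_iff he.idem).1 (hsup.le (Submodule.mem_sup_right hn'))
  have h1 : n * n + n * n' = n := by rw [← mul_add, hsum, hne]
  have h2 : n' * n + n' * n' = n' := by rw [← mul_add, hsum, hne']
  have hz : n * n' ∈ N ⊓ N' :=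
    ⟨eq_sub_of_add_eq' h1 ▸ N.sub_mem hn (N.smul_mem n hn), N'.smul_mem n hn'⟩
  have hz' : n' * n ∈ N ⊓ N' :=
    ⟨N.smul_mem n' hn, eq_sub_of_add_eq h2 ▸ N'.sub_mem hn' (N'.smul_mem n' hn')⟩
  rw [hinf, Submodule.mem_bot] at hz hz'
  rw [hz, add_zero] at h1
  have hen : e * n = n := by rw [← hsum, add_mul, h1, hz', add_zero]
  rcases he.eq_zero_or_eq n ⟨0, hn0⟩ h1 hen hne with h | h
  · left
    rw [h, zero_add] at hsum
    rw [hsum, ← Submodule.span_singleton_le_iff_mem] at hn'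
    exact le_bot_iff.1 (hinf ▸ le_inf le_rfl ((le_sup_left.trans hsup.le).trans hn'))
  · right
    rw [h, ← Submodule.span_singleton_le_iff_mem] at hn
    exact le_bot_iff.1 (hinf ▸ le_inf ((le_sup_right.trans hsup.le).trans hn) le_rfl)

theorem IsPrimitiveIdem.isGradedIndecomposable_right {e : R}
    (he : IsPrimitiveIdem (SetLike.homogeneousSubmonoid 𝒜) e) :
    IsGradedIndecomposableSubmodule 𝒜 (Submodule.span Rᵐᵒᵖ {e}) := by
  have he0 := mem_zero_of_idem he.mem he.idem
  refine ⟨isHomogeneous_span_right 0 e he0, mt Submodule.span_singleton_eq_bot.1 he.ne_zero,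
    fun N N' hN hN' hsup hinf => ?_⟩
  obtain ⟨n, hn, n', hn', hnn⟩ :=
    Submodule.mem_sup.1 (hsup ▸ Submodule.mem_span_singleton_self e : e ∈ N ⊔ N')
  have hsum : (decompose 𝒜 n 0 : R) + decompose 𝒜 n' 0 = e := by
    rw [← AddSubgroup.coe_add, ← DirectSum.add_apply, ← decompose_add, hnn,
      decompose_of_mem_same 𝒜 he0]
  replace hn := hN 0 hn
  replace hn' := hN' 0 hn'
  have hn0 : (decompose 𝒜 n 0 : R) ∈ 𝒜 0 := SetLike.coe_mem _
  generalize (decompose 𝒜 n 0 : R) = n at *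
  generalize (decompose 𝒜 n' 0 : R) = n' at *
  have hen : e * n = n :=
    (mem_span_right_idem_iff he.idem).1 (hsup.le (Submodule.mem_sup_left hn))
  have hen' : e * n' = n' :=
    (mem_span_right_idem_iff he.idem).1 (hsup.le (Submodule.mem_sup_right hn'))
  have h1 : n * n + n' * n = n := by rw [← add_mul, hsum, hen]
  have h2 : n * n' + n' * n' = n' := by rw [← add_mul, hsum, hen']
  have hz : n' * n ∈ N ⊓ N' :=
    ⟨eq_sub_of_add_eq' h1 ▸ N.sub_mem hn (N.smul_mem (op n) hn), N'.smul_mem (op n) hn'⟩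
  have hz' : n * n' ∈ N ⊓ N' :=
    ⟨N.smul_mem (op n') hn, eq_sub_of_add_eq h2 ▸ N'.sub_mem hn' (N'.smul_mem (op n') hn')⟩
  rw [hinf, Submodule.mem_bot] at hz hz'
  rw [hz, add_zero] at h1
  have hne : n * e = n := by rw [← hsum, mul_add, h1, hz', add_zero]
  rcases he.eq_zero_or_eq n ⟨0, hn0⟩ h1 hen hne with h | h
  · left
    rw [h, zero_add] at hsum
    rw [hsum, ← Submodule.span_singleton_le_iff_mem] at hn'
    exact le_bot_iff.1 (hinf ▸ le_inf le_rfl ((le_sup_left.trans hsup.le).trans hn'))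
  · right
    rw [h, ← Submodule.span_singleton_le_iff_mem] at hn
    exact le_bot_iff.1 (hinf ▸ le_inf ((le_sup_right.trans hsup.le).trans hn) le_rfl)

theorem isGradedIndecomposableFactor_left {n : ℕ} {e : Fin n → R}
    (he : ∀ i, IsPrimitiveIdem (SetLike.homogeneousSubmonoid 𝒜) (e i)) (hsum : ∑ i, e i = 1)
    (horth : ∀ i j, i ≠ j → e i * e j = 0) (i : Fin n) :
    IsGradedIndecomposableFactor 𝒜 (Submodule.span R {e i}) := by
  refine ⟨n, fun i => Submodule.span R {e i}, fun i => (he i).isGradedIndecomposable_left,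
    (DirectSum.isInternal_submodule_iff_iSupIndep_and_iSup_eq_top _).2 ⟨fun i => ?_, ?_⟩, i, rfl⟩
  · rw [Submodule.disjoint_def]
    intro x hx hx'
    -- Right multiplication by `e i` kills every other summand and is the identity on `R (e i)`.
    have hle : (⨆ j, ⨆ _ : j ≠ i, Submodule.span R {e j}) ≤
        LinearMap.ker (LinearMap.toSpanSingleton R R (e i)) :=
      iSup₂_le fun j hj => (Submodule.span_singleton_le_iff_mem _ _).2 (horth j i hj)
    exact ((mem_span_left_idem_iff (he i).idem).1 hx).symm.trans (hle hx')
  · refine eq_top_iff.2 fun x _ => ?_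
    rw [← mul_one x, ← hsum, Finset.mul_sum]
    exact Submodule.sum_mem _ fun i _ => Submodule.mem_iSup_of_mem i (mem_span_left_iff.2 ⟨x, rfl⟩)

theorem isGradedIndecomposableFactor_right {n : ℕ} {e : Fin n → R}
    (he : ∀ i, IsPrimitiveIdem (SetLike.homogeneousSubmonoid 𝒜) (e i)) (hsum : ∑ i, e i = 1)
    (horth : ∀ i j, i ≠ j → e i * e j = 0) (i : Fin n) :
    IsGradedIndecomposableFactor 𝒜 (Submodule.span Rᵐᵒᵖ {e i}) := by
  refine ⟨n, fun i => Submodule.span Rᵐᵒᵖ {e i}, fun i => (he i).isGradedIndecomposable_right,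
    (DirectSum.isInternal_submodule_iff_iSupIndep_and_iSup_eq_top _).2 ⟨fun i => ?_, ?_⟩, i, rfl⟩
  · rw [Submodule.disjoint_def]
    intro x hx hx'
    have hle : (⨆ j, ⨆ _ : j ≠ i, Submodule.span Rᵐᵒᵖ {e j}) ≤
        LinearMap.ker (DistribSMul.toLinearMap Rᵐᵒᵖ R (e i)) :=
      iSup₂_le fun j hj => (Submodule.span_singleton_le_iff_mem _ _).2 (horth i j hj.symm)
    exact ((mem_span_right_idem_iff (he i).idem).1 hx).symm.trans (hle hx')
  · refine eq_top_iff.2 fun x _ => ?_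
    rw [← one_mul x, ← hsum, Finset.sum_mul]
    exact Submodule.sum_mem _ fun i _ =>
      Submodule.mem_iSup_of_mem i (mem_span_right_iff.2 ⟨x, rfl⟩)

/-- A graded Artinian ring has a finite complete family of orthogonal primitive idempotents. -/
theorem IsGradedArtinian.exists_primitive_idempotents (hR : IsGradedArtinian 𝒜) :
    ∃ (n : ℕ) (e : Fin n → R), (∀ i, IsPrimitiveIdem (SetLike.homogeneousSubmonoid 𝒜) (e i)) ∧
      ∑ i, e i = 1 ∧ ∀ i j, i ≠ j → e i * e j = 0 := by
  classical
  have main : ∀ f ∈ SetLike.homogeneousSubmonoid 𝒜, f * f = f →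
      ∃ (ι : Type) (_ : Fintype ι) (e : ι → R),
        (∀ i, IsPrimitiveIdem (SetLike.homogeneousSubmonoid 𝒜) (e i)) ∧
        ∑ i, e i = f ∧ ∀ i j, i ≠ j → e i * e j = 0 := by
    by_contra! hcon
    obtain ⟨f, hf, hff, hnf⟩ := hcon
    -- A counterexample `f` with `Rf` minimal: it is neither zero nor primitive, so it splits as `p
    -- + (f - p)`, and both pieces generate strictly smaller left ideals.
    obtain ⟨-, -, ⟨f, hf, hff, rfl, hnf⟩, hmin⟩ := hR.1.exists_minimal (p := fun N =>
      ∃ f ∈ SetLike.homogeneousSubmonoid 𝒜, f * f = f ∧ N = Submodule.span R {f} ∧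
        ¬ ∃ (ι : Type) (_ : Fintype ι) (e : ι → R),
        (∀ i, IsPrimitiveIdem (SetLike.homogeneousSubmonoid 𝒜) (e i)) ∧
        ∑ i, e i = f ∧ ∀ i j, i ≠ j → e i * e j = 0)
      ⟨_, isHomogeneous_span_left 0 f (mem_zero_of_idem hf hff), f, hf, hff, rfl, by
        rintro ⟨ι, _, e, h1, h2, h3⟩
        obtain ⟨i, j, hij, hne⟩ := hnf ι _ e h1 h2
        exact hne (h3 i j hij)⟩
    have hf0 : f ≠ 0 := by
      rintro rfl
      exact hnf ⟨Empty, inferInstance, Empty.elim, fun i => i.elim, by simp, fun i => i.elim⟩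
    have hprim : ¬ IsPrimitiveIdem (SetLike.homogeneousSubmonoid 𝒜) f := fun h =>
      hnf ⟨Unit, inferInstance, fun _ => f, fun _ => h, by simp, fun i j hij => (hij rfl).elim⟩
    obtain ⟨p, hp, hpp, hfp, hpf, hp0, hpne⟩ : ∃ p ∈ SetLike.homogeneousSubmonoid 𝒜,
        p * p = p ∧ f * p = p ∧ p * f = p ∧ p ≠ 0 ∧ p ≠ f := by
      by_contra! h
      refine hprim ⟨hf, hff, hf0, fun p hp h1 h2 h3 => or_iff_not_imp_left.2 (h p hp h1 h2 h3)⟩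
    have smaller : ∀ p ∈ SetLike.homogeneousSubmonoid 𝒜, p * p = p → f * p = p → p * f = p →
        p ≠ f → ∃ (ι : Type) (_ : Fintype ι) (e : ι → R),
        (∀ i, IsPrimitiveIdem (SetLike.homogeneousSubmonoid 𝒜) (e i)) ∧
        ∑ i, e i = p ∧ ∀ i j, i ≠ j → e i * e j = 0 := by
      intro p hp hpp hfp hpf hne
      by_contra hnp
      have := hmin _ (isHomogeneous_span_left 0 p (mem_zero_of_idem hp hpp))
        ⟨p, hp, hpp, rfl, hnp⟩
        ((Submodule.span_singleton_le_iff_mem _ _).2 (mem_span_left_iff.2 ⟨p, hpf⟩))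
      have hfm : f ∈ Submodule.span R {p} := this ▸ Submodule.mem_span_singleton_self f
      exact hne (hfp.symm.trans ((mem_span_left_idem_iff hpp).1 hfm))
    have hq : f - p ∈ SetLike.homogeneousSubmonoid 𝒜 :=
      ⟨0, sub_mem (mem_zero_of_idem hf hff) (mem_zero_of_idem hp hpp)⟩
    have hfq : f * (f - p) = f - p := by rw [mul_sub, hff, hfp]
    have hqf : (f - p) * f = f - p := by rw [sub_mul, hff, hpf]
    have hpq : p * (f - p) = 0 := by rw [mul_sub, hpf, hpp, sub_self]
    have hqp : (f - p) * p = 0 := by rw [sub_mul, hfp, hpp, sub_self]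
    have hqq : (f - p) * (f - p) = f - p := by rw [sub_mul, hfq, hpq, sub_zero]
    obtain ⟨ι, _, e, he, hsum, horth⟩ := smaller p hp hpp hfp hpf hpne
    obtain ⟨ι', _, e', he', hsum', horth'⟩ := smaller (f - p) hq hqq hfq hqf
      (fun h => hp0 (by rw [← sub_sub_cancel f p, h, sub_self]))
    have absorb : ∀ {κ : Type} [Fintype κ] {d : κ → R} {x : R},
        (∀ i, d i * d i = d i) → ∑ i, d i = x → (∀ i j, i ≠ j → d i * d j = 0) →
        ∀ i, x * d i = d i ∧ d i * x = d i := by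
      intro κ _ d x hd hx ho i
      rw [← hx, Finset.sum_mul, Finset.mul_sum]
      exact ⟨(Finset.sum_eq_single i (fun j _ hj => ho j i hj) (by simp)).trans (hd i),
        (Finset.sum_eq_single i (fun j _ hj => ho i j hj.symm) (by simp)).trans (hd i)⟩
    have ha := absorb (fun i => (he i).idem) hsum horth
    have ha' := absorb (fun i => (he' i).idem) hsum' horth'
    refine hnf ⟨ι ⊕ ι', inferInstance, Sum.elim e e', ?_, ?_, ?_⟩
    · rintro (i | i)
      exacts [he i, he' i]
    · rw [Fintype.sum_sum_type]
      simp only [Sum.elim_inl, Sum.elim_inr, hsum, hsum']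
      exact add_sub_cancel _ _
    · rintro (i | i) (j | j) hij
      · exact horth i j fun h => hij (h ▸ rfl)
      · change e i * e' j = 0
        rw [← (ha i).2, ← (ha' j).1, mul_assoc, ← mul_assoc p, hpq, zero_mul, mul_zero]
      · change e' i * e j = 0
        rw [← (ha' i).2, ← (ha j).1, mul_assoc, ← mul_assoc _ p, hqp, zero_mul, mul_zero]
      · exact horth' i j fun h => hij (h ▸ rfl)
  obtain ⟨ι, _, e, he, hsum, horth⟩ := main 1 (Submonoid.one_mem _) (one_mul 1)
  refine ⟨Fintype.card ι, e ∘ (Fintype.equivFin ι).symm, fun i => he _, ?_,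
    fun i j hij => horth _ _ ((Fintype.equivFin ι).symm.injective.ne hij)⟩
  rw [← hsum]
  exact Equiv.sum_comp (Fintype.equivFin ι).symm e

end GradedRings

end GradedQF

namespace GradedQF

open DirectSum MulOpposite

/-! ### Annihilators of graded ideals are graded ideals -/

section Annihilators

variable {G : Type v} [AddGroup G] [DecidableEq G] {R : Type u} [Ring R]
  {𝒜 : G → AddSubgroup R} [GradedRing 𝒜]

/-- The right annihilator as a right ideal. -/
def rightAnnIdeal (X : Set R) : Submodule Rᵐᵒᵖ R where
  carrier := rightAnn X
  add_mem' ha hb x hx := by rw [mul_add, ha x hx, hb x hx, add_zero]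
  zero_mem' x _ := mul_zero x
  smul_mem' c a ha x hx := by
    change x * (a * c.unop) = 0
    rw [← mul_assoc, ha x hx, zero_mul]

/-- The left annihilator as a left ideal. -/
def leftAnnIdeal (X : Set R) : Submodule R R where
  carrier := leftAnn X
  add_mem' ha hb x hx := by rw [add_mul, ha x hx, hb x hx, add_zero]
  zero_mem' x _ := zero_mul x
  smul_mem' c a ha x hx := by rw [smul_eq_mul, mul_assoc, ha x hx, mul_zero]

/-- For homogeneous `x`, the equation `x * a = 0` holds component by component in `a`, and a graded
ideal is killed once its homogeneous elements are. -/
theorem isHomogeneous_rightAnnIdeal {N : Submodule R R} (hN : N.IsHomogeneous 𝒜) :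
    (rightAnnIdeal (N : Set R)).IsHomogeneous 𝒜 := by
  intro i a ha
  have hle : N ≤ LinearMap.ker (LinearMap.toSpanSingleton R R (decompose 𝒜 a i : R)) := by
    refine le_of_forall_homogeneous hN fun j x hx hxN => ?_
    change x * (decompose 𝒜 a i : R) = 0
    rw [← coe_decompose_mul_add_of_left_mem 𝒜 hx, ha x hxN, decompose_zero]
    rfl
  exact fun x hx => hle hx

theorem isHomogeneous_leftAnnIdeal {N : Submodule Rᵐᵒᵖ R} (hN : N.IsHomogeneous 𝒜) :
    (leftAnnIdeal (N : Set R)).IsHomogeneous 𝒜 := by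
  intro i a ha
  have hle : N ≤ LinearMap.ker (DistribSMul.toLinearMap Rᵐᵒᵖ R (decompose 𝒜 a i : R)) := by
    refine le_of_forall_homogeneous hN fun j x hx hxN => ?_
    change (decompose 𝒜 a i : R) * x = 0
    rw [← coe_decompose_mul_add_of_right_mem 𝒜 hx, ha x hxN, decompose_zero]
    rfl
  exact fun x hx => hle hx

end Annihilators

/-! ### Quasi-Frobenius rings satisfy both conditions -/

section QuasiFrobenius

variable {G : Type v} [AddGroup G] [DecidableEq G] {R : Type u} [Ring R]
  {𝒜 : G → AddSubgroup R} [GradedRing 𝒜]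

theorem IsLocalIdem.not_isNilpotent_and {H : Submonoid R} {e c d : R} (he : IsLocalIdem H e)
    (hc : e * c = c ∧ c * e = c) (hcd : c + d = e) : ¬ (IsNilpotent c ∧ IsNilpotent d) := by
  rintro ⟨h1, h2⟩
  have hcomm : Commute c d := by
    rw [← eq_sub_iff_add_eq'] at hcd
    rw [hcd, commute_iff_eq, mul_sub, sub_mul, hc.1, hc.2]
  exact not_isNilpotent_of_mul_eq he.ne_zero he.idem (hcd ▸ hcomm.isNilpotent_add h1 h2)

theorem IsGradedQuasiFrobenius.leftGradedSimplesEmbed (h : IsGradedQuasiFrobenius 𝒜) :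
    LeftGradedSimplesEmbed 𝒜 := by
  intro S _ _ 𝒮 _ _ hS
  obtain ⟨hS0, -⟩ := id hS
  obtain ⟨τ, s, hs, -, hs0⟩ := exists_homogeneous_ne_zero (A := R) (ℳ := 𝒮) isHomogeneous_top
    top_ne_bot
  set φ : R →ₗ[R] S := LinearMap.toSpanSingleton R S s
  have hφ : ∀ g, ∀ x ∈ 𝒜 g, φ x ∈ 𝒮 (Equiv.addRight τ g) := fun g x hx =>
    SetLike.GradedSMul.smul_mem hx hs
  have hφ1 : φ 1 = s := one_smul R s
  have hker := isHomogeneous_ker φ (Equiv.addRight τ).injective hφ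
  -- Otherwise the double annihilator of the kernel would be all of `R`, whereas `1` is not in the
  -- kernel.
  have hann : rightAnnIdeal (LinearMap.ker φ : Set R) ≠ ⊥ := by
    intro h0
    have h1 : (1 : R) ∈ leftAnn (rightAnn (LinearMap.ker φ : Set R)) := by
      intro x hx
      have hx' : x ∈ rightAnnIdeal (LinearMap.ker φ : Set R) := hx
      rw [h0, Submodule.mem_bot] at hx'
      rw [hx', mul_zero]
    rw [h.2.2 _ hker] at h1
    exact hs0 (hφ1.symm.trans h1)
  obtain ⟨γ, x, hx, hxann, hx0⟩ :=
    exists_homogeneous_ne_zero (isHomogeneous_rightAnnIdeal hker) hann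
  obtain ⟨f, hf, hdeg⟩ := exists_injective_of_isGradedSimple (ℳ := 𝒜) (𝒩 := 𝒜) hS
    (ψ := LinearMap.toSpanSingleton R R x) (ε := Equiv.addRight γ) hφ
    (fun g y hy => SetLike.GradedMul.mul_mem hy hx)
    (fun h0 => hs0 (by rw [← hφ1, h0, LinearMap.zero_apply]))
    (fun h0 => hx0 (by
      have := LinearMap.congr_fun h0 1
      rwa [LinearMap.toSpanSingleton_apply, one_smul] at this))
    (fun a ha => hxann a ha)
  -- `f` maps degree `g + τ` to degree `g + γ`; replacing `g` by `g - γ` yields this shift.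
  refine ⟨-γ + τ, f, fun g m hm => ?_, hf⟩
  have := hdeg (g - γ) m (by
    change m ∈ 𝒮 (g - γ + τ)
    rwa [sub_eq_add_neg, add_assoc])
  change f m ∈ 𝒜 (g - γ + γ) at this
  rwa [sub_add_cancel] at this

theorem IsGradedQuasiFrobenius.rightGradedSimplesEmbed (h : IsGradedQuasiFrobenius 𝒜) :
    RightGradedSimplesEmbed 𝒜 := by
  intro S _ _ 𝒮 _ hgr hS
  obtain ⟨hS0, -⟩ := id hS
  obtain ⟨τ, s, hs, -, hs0⟩ := exists_homogeneous_ne_zero (A := Rᵐᵒᵖ) (ℳ := 𝒮) isHomogeneous_top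
    top_ne_bot
  let φ : R →ₗ[Rᵐᵒᵖ] S :=
    { toFun := fun a => op a • s
      map_add' := fun a b => by rw [op_add, add_smul]
      map_smul' := fun a b => by
        rw [RingHom.id_apply, smul_smul]
        rfl }
  have hφ : ∀ g, ∀ x ∈ 𝒜 g, φ x ∈ 𝒮 (Equiv.addLeft τ g) := fun g x hx => hgr τ g s hs x hx
  have hφ1 : φ 1 = s := one_smul Rᵐᵒᵖ s
  have hker := isHomogeneous_ker φ (Equiv.addLeft τ).injective hφ
  have hann : leftAnnIdeal (LinearMap.ker φ : Set R) ≠ ⊥ := by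
    intro h0
    have h1 : (1 : R) ∈ rightAnn (leftAnn (LinearMap.ker φ : Set R)) := by
      intro x hx
      have hx' : x ∈ leftAnnIdeal (LinearMap.ker φ : Set R) := hx
      rw [h0, Submodule.mem_bot] at hx'
      rw [hx', zero_mul]
    rw [h.2.1 _ hker] at h1
    exact hs0 (hφ1.symm.trans h1)
  obtain ⟨γ, x, hx, hxann, hx0⟩ :=
    exists_homogeneous_ne_zero (isHomogeneous_leftAnnIdeal hker) hann
  obtain ⟨f, hf, hdeg⟩ := exists_injective_of_isGradedSimple (ℳ := 𝒜) (𝒩 := 𝒜) hS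
    (ψ := DistribSMul.toLinearMap Rᵐᵒᵖ R x) (ε := Equiv.addLeft γ) hφ
    (fun g y hy => SetLike.GradedMul.mul_mem hx hy)
    (fun h0 => hs0 (by rw [← hφ1, h0, LinearMap.zero_apply]))
    (fun h0 => hx0 (by
      have := LinearMap.congr_fun h0 1
      change x * 1 = 0 at this
      rwa [mul_one] at this))
    (fun a ha => hxann a ha)
  refine ⟨τ - γ, f, fun g m hm => ?_, hf⟩
  have := hdeg (-γ + g) m (by
    change m ∈ 𝒮 (τ + (-γ + g))
    rwa [← add_assoc, ← sub_eq_add_neg])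
  change f m ∈ 𝒜 (γ + (-γ + g)) at this
  rwa [add_neg_cancel_left] at this

/-- If `N ⊓ N' = ⊥`, the sum of the right annihilators has zero left annihilator, hence is `R`.
Writing `1 = m + m'` splits `e` into `e m e + e m' e`, which locality forbids when both terms are
nilpotent. -/
theorem IsGradedQuasiFrobenius.existsUnique_left (h : IsGradedQuasiFrobenius 𝒜) {e : R}
    (he : IsLocalIdem (SetLike.homogeneousSubmonoid 𝒜) e) :
    ∃! N : Submodule R R, N ≤ Submodule.span R {e} ∧ IsGradedSimpleSubmodule 𝒜 N := by
  have he0 := mem_zero_of_idem he.mem he.idem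
  refine h.1.1.existsUnique_isGradedSimpleSubmodule (isHomogeneous_span_left 0 e he0)
    (mt Submodule.span_singleton_eq_bot.1 he.ne_zero) fun N N' hN hN' hNe hNe' hinf => ?_
  by_contra! hne
  have h1 : (1 : R) ∈ rightAnnIdeal (N : Set R) ⊔ rightAnnIdeal (N' : Set R) := by
    rw [← SetLike.mem_coe, ← h.2.1 _ (isHomogeneous_sup (isHomogeneous_rightAnnIdeal hN)
      (isHomogeneous_rightAnnIdeal hN'))]
    intro a ha
    have haN : a ∈ N ⊓ N' := by
      constructor
      · rw [← h.2.2 N hN]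
        exact fun x hx => ha x (Submodule.mem_sup_left hx)
      · rw [← h.2.2 N' hN']
        exact fun x hx => ha x (Submodule.mem_sup_right hx)
    rw [hinf, Submodule.mem_bot] at haN
    rw [haN, zero_mul]
  obtain ⟨m, hm, m', hm', hmm⟩ := Submodule.mem_sup.1 h1
  have hsum : (decompose 𝒜 m 0 : R) + decompose 𝒜 m' 0 = 1 := by
    rw [← AddSubgroup.coe_add, ← DirectSum.add_apply, ← decompose_add, hmm,
      decompose_of_mem_same 𝒜 SetLike.GradedOne.one_mem]
  -- A non-zero `x ∈ K` satisfies `x * e = x` and `x * m = 0`, so `e * m * e` cannot be a unit of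
  -- the corner.
  have key : ∀ (K : Submodule R R) (m : R), K ≤ Submodule.span R {e} → K ≠ ⊥ → m ∈ 𝒜 0 →
      m ∈ rightAnnIdeal (K : Set R) → IsNilpotent (e * m * e) := by
    intro K m hKe hK0 hm0 hm
    refine (he.nilpotent_or_unit (e * m * e)
      (mul_mem (mul_mem he.mem ⟨0, hm0⟩) he.mem) (by simp only [← mul_assoc, he.idem])
      (by rw [mul_assoc, he.idem])).resolve_right ?_
    rintro ⟨d, -, -, -, hd, -⟩
    obtain ⟨x, hx, hx0⟩ := Submodule.exists_mem_ne_zero_of_ne_bot hK0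
    have hxe := (mem_span_left_idem_iff he.idem).1 (hKe hx)
    refine hx0 ?_
    calc x = x * (e * m * e * d) := by rw [hd, hxe]
      _ = x * e * m * (e * d) := by simp only [mul_assoc]
      _ = 0 := by rw [hxe, hm x hx, zero_mul]
  refine he.not_isNilpotent_and (c := e * decompose 𝒜 m 0 * e) (d := e * decompose 𝒜 m' 0 * e)
    ⟨by simp only [← mul_assoc, he.idem], by rw [mul_assoc, he.idem]⟩ ?_
    ⟨key N _ hNe hne.1 (SetLike.coe_mem _) (isHomogeneous_rightAnnIdeal hN 0 hm),
      key N' _ hNe' hne.2 (SetLike.coe_mem _) (isHomogeneous_rightAnnIdeal hN' 0 hm')⟩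
  rw [← add_mul, ← mul_add, hsum, mul_one, he.idem]

theorem IsGradedQuasiFrobenius.existsUnique_right (h : IsGradedQuasiFrobenius 𝒜) {e : R}
    (he : IsLocalIdem (SetLike.homogeneousSubmonoid 𝒜) e) :
    ∃! N : Submodule Rᵐᵒᵖ R, N ≤ Submodule.span Rᵐᵒᵖ {e} ∧ IsGradedSimpleSubmodule 𝒜 N := by
  have he0 := mem_zero_of_idem he.mem he.idem
  refine h.1.2.existsUnique_isGradedSimpleSubmodule (isHomogeneous_span_right 0 e he0)
    (mt Submodule.span_singleton_eq_bot.1 he.ne_zero) fun N N' hN hN' hNe hNe' hinf => ?_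
  by_contra! hne
  have h1 : (1 : R) ∈ leftAnnIdeal (N : Set R) ⊔ leftAnnIdeal (N' : Set R) := by
    rw [← SetLike.mem_coe, ← h.2.2 _ (isHomogeneous_sup (isHomogeneous_leftAnnIdeal hN)
      (isHomogeneous_leftAnnIdeal hN'))]
    intro a ha
    have haN : a ∈ N ⊓ N' := by
      constructor
      · rw [← h.2.1 N hN]
        exact fun x hx => ha x (Submodule.mem_sup_left hx)
      · rw [← h.2.1 N' hN']
        exact fun x hx => ha x (Submodule.mem_sup_right hx)
    rw [hinf, Submodule.mem_bot] at haN
    rw [haN, mul_zero]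
  obtain ⟨m, hm, m', hm', hmm⟩ := Submodule.mem_sup.1 h1
  have hsum : (decompose 𝒜 m 0 : R) + decompose 𝒜 m' 0 = 1 := by
    rw [← AddSubgroup.coe_add, ← DirectSum.add_apply, ← decompose_add, hmm,
      decompose_of_mem_same 𝒜 SetLike.GradedOne.one_mem]
  have key : ∀ (K : Submodule Rᵐᵒᵖ R) (m : R), K ≤ Submodule.span Rᵐᵒᵖ {e} → K ≠ ⊥ → m ∈ 𝒜 0 →
      m ∈ leftAnnIdeal (K : Set R) → IsNilpotent (e * m * e) := by
    intro K m hKe hK0 hm0 hm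
    refine (he.nilpotent_or_unit (e * m * e)
      (mul_mem (mul_mem he.mem ⟨0, hm0⟩) he.mem) (by simp only [← mul_assoc, he.idem])
      (by rw [mul_assoc, he.idem])).resolve_right ?_
    rintro ⟨d, -, -, -, -, hd⟩
    obtain ⟨x, hx, hx0⟩ := Submodule.exists_mem_ne_zero_of_ne_bot hK0
    have hxe := (mem_span_right_idem_iff he.idem).1 (hKe hx)
    refine hx0 ?_
    calc x = d * (e * m * e) * x := by rw [hd, hxe]
      _ = d * e * (m * (e * x)) := by simp only [mul_assoc]
      _ = 0 := by rw [hxe, hm x hx, mul_zero]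
  refine he.not_isNilpotent_and (c := e * decompose 𝒜 m 0 * e) (d := e * decompose 𝒜 m' 0 * e)
    ⟨by simp only [← mul_assoc, he.idem], by rw [mul_assoc, he.idem]⟩ ?_
    ⟨key N _ hNe hne.1 (SetLike.coe_mem _) (isHomogeneous_leftAnnIdeal hN 0 hm),
      key N' _ hNe' hne.2 (SetLike.coe_mem _) (isHomogeneous_leftAnnIdeal hN' 0 hm')⟩
  rw [← add_mul, ← mul_add, hsum, mul_one, he.idem]

end QuasiFrobenius

/-! ### From the two conditions to the double annihilator property -/

section Kasch

variable {G : Type v} [AddGroup G] [DecidableEq G] {R : Type u} [Ring R]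
  {𝒜 : G → AddSubgroup R} [GradedRing 𝒜]

theorem exists_isLeftSocleGenerator (hR : IsGradedArtinian 𝒜) {e : R} (he : e * e = e)
    (huniq : ∃! N : Submodule R R, N ≤ Submodule.span R {e} ∧ IsGradedSimpleSubmodule 𝒜 N) :
    ∃ s, IsLeftSocleGenerator (SetLike.homogeneousSubmonoid 𝒜) e s := by
  obtain ⟨i, s, hs, hs0, hse, hgen⟩ := hR.1.exists_socle_generator isHomogeneous_span_left huniq
  refine ⟨s, ⟨i, hs⟩, hs0, (mem_span_left_idem_iff he).1 hse, ?_⟩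
  rintro x ⟨j, hx⟩ hx0 hxe
  exact mem_span_left_iff.1 (hgen j x hx hx0 ((mem_span_left_idem_iff he).2 hxe))

theorem exists_isRightSocleGenerator (hR : IsGradedArtinian 𝒜) {e : R} (he : e * e = e)
    (huniq : ∃! N : Submodule Rᵐᵒᵖ R,
      N ≤ Submodule.span Rᵐᵒᵖ {e} ∧ IsGradedSimpleSubmodule 𝒜 N) :
    ∃ s, IsRightSocleGenerator (SetLike.homogeneousSubmonoid 𝒜) e s := by
  obtain ⟨i, s, hs, hs0, hse, hgen⟩ := hR.2.exists_socle_generator isHomogeneous_span_right huniq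
  refine ⟨s, ⟨i, hs⟩, hs0, (mem_span_right_idem_iff he).1 hse, ?_⟩
  rintro x ⟨j, hx⟩ hx0 hxe
  exact mem_span_right_iff.1 (hgen j x hx hx0 ((mem_span_right_idem_iff he).2 hxe))

/-- Embed `R ⧸ K`, where `K` is a maximal proper graded left ideal containing `1 - e`. The image of
`1` has annihilator `K`, so it is simple and fixed by `e`. -/
theorem LeftGradedSimplesEmbed.exists_isLeftSimpleElem (h : LeftGradedSimplesEmbed 𝒜) {e : R}
    (he : e ∈ 𝒜 0) (hee : e * e = e) (he0 : e ≠ 0) :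
    ∃ x, IsLeftSimpleElem (SetLike.homogeneousSubmonoid 𝒜) x ∧ e * x = x := by
  have h1e : (1 : R) ∉ Submodule.span R {1 - e} := by
    intro h
    obtain ⟨a, ha⟩ := mem_span_left_iff.1 h
    refine he0 ?_
    rw [← one_mul e, ← ha, mul_assoc, sub_mul, hee, one_mul, sub_self, mul_zero]
  obtain ⟨K, hK, hle, h1K, hmax⟩ := exists_maximal_homogeneous
    (isHomogeneous_span_left 0 (1 - e) (sub_mem SetLike.GradedOne.one_mem he)) h1e
  have htop : ∀ N : Submodule R R, (1 : R) ∈ N → N = ⊤ :=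
    fun N hN => Ideal.eq_top_of_isUnit_mem N hN isUnit_one
  let _ := quotientDecomposition hK
  have : SetLike.GradedSMul 𝒜 (quotientGrading 𝒜 K) := ⟨by
    rintro i j a - ha ⟨y, hy, rfl⟩
    exact ⟨a * y, SetLike.GradedMul.mul_mem ha hy, rfl⟩⟩
  obtain ⟨σ, f, hf, hinj⟩ := h (R ⧸ K) (quotientGrading 𝒜 K)
    (isGradedSimple_quotient hK h1K htop hmax)
  have hfa : ∀ a : R, f (K.mkQ a) = a * f (K.mkQ 1) := by
    intro a
    rw [← smul_eq_mul, ← map_smul, ← map_smul, smul_eq_mul, mul_one]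
  have hf0 : ∀ a, a * f (K.mkQ 1) = 0 ↔ a ∈ K := by
    intro a
    rw [← hfa, map_eq_zero_iff f hinj]
    exact Submodule.Quotient.mk_eq_zero K
  refine ⟨f (K.mkQ 1), ⟨⟨-σ, hf _ _ ?_⟩, fun h0 => h1K ((hf0 1).1 (by rw [h0, mul_zero])), ?_⟩, ?_⟩
  · change _ ∈ quotientGrading 𝒜 K (-σ + σ)
    rw [neg_add_cancel]
    exact mk_mem_quotientGrading K SetLike.GradedOne.one_mem
  · rintro a ⟨i, ha⟩ hne
    have haK : a ∉ K := mt (hf0 a).2 hne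
    have h1 : (1 : R) ∈ K ⊔ Submodule.span R {a} := by
      by_contra h1
      have := hmax _ (isHomogeneous_sup hK (isHomogeneous_span_left i a ha)) le_sup_left h1
      exact haK (this.le (Submodule.mem_sup_right (Submodule.mem_span_singleton_self a)))
    obtain ⟨m, hm, c, hc, hmc⟩ := Submodule.mem_sup.1 h1
    obtain ⟨b, rfl⟩ := mem_span_left_iff.1 hc
    refine ⟨b, ?_⟩
    rw [← mul_assoc, ← zero_add (b * a * _), ← (hf0 m).2 hm, ← add_mul, hmc, one_mul]
  · have := (hf0 (1 - e)).2 (hle (Submodule.mem_span_singleton_self _))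
    rw [sub_mul, one_mul, sub_eq_zero] at this
    exact this.symm

theorem RightGradedSimplesEmbed.exists_isRightSimpleElem (h : RightGradedSimplesEmbed 𝒜) {e : R}
    (he : e ∈ 𝒜 0) (hee : e * e = e) (he0 : e ≠ 0) :
    ∃ x, IsRightSimpleElem (SetLike.homogeneousSubmonoid 𝒜) x ∧ x * e = x := by
  have h1e : (1 : R) ∉ Submodule.span Rᵐᵒᵖ {1 - e} := by
    intro h
    obtain ⟨a, ha⟩ := mem_span_right_iff.1 h
    refine he0 ?_
    rw [← mul_one e, ← ha, ← mul_assoc, mul_sub, hee, mul_one, sub_self, zero_mul]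
  obtain ⟨K, hK, hle, h1K, hmax⟩ := exists_maximal_homogeneous
    (isHomogeneous_span_right 0 (1 - e) (sub_mem SetLike.GradedOne.one_mem he)) h1e
  have htop : ∀ N : Submodule Rᵐᵒᵖ R, (1 : R) ∈ N → N = ⊤ := fun N hN =>
    eq_top_iff.2 fun x _ => by
      have := N.smul_mem (op x) hN
      rwa [op_smul_eq_mul, one_mul] at this
  let _ := quotientDecomposition hK
  have hgr : IsGradedRightModule 𝒜 (quotientGrading 𝒜 K) := by
    rintro i j - ⟨y, hy, rfl⟩ a ha
    exact ⟨y * a, SetLike.GradedMul.mul_mem hy ha, rfl⟩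
  obtain ⟨σ, f, hf, hinj⟩ := h (R ⧸ K) (quotientGrading 𝒜 K) hgr
    (isGradedSimple_quotient hK h1K htop hmax)
  have hfa : ∀ a : R, f (K.mkQ a) = f (K.mkQ 1) * a := by
    intro a
    rw [← op_smul_eq_mul, ← map_smul, ← map_smul, op_smul_eq_mul, one_mul]
  have hf0 : ∀ a, f (K.mkQ 1) * a = 0 ↔ a ∈ K := by
    intro a
    rw [← hfa, map_eq_zero_iff f hinj]
    exact Submodule.Quotient.mk_eq_zero K
  refine ⟨f (K.mkQ 1), ⟨⟨-σ, hf _ _ ?_⟩, fun h0 => h1K ((hf0 1).1 (by rw [h0, zero_mul])), ?_⟩, ?_⟩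
  · change _ ∈ quotientGrading 𝒜 K (σ + -σ)
    rw [add_neg_cancel]
    exact mk_mem_quotientGrading K SetLike.GradedOne.one_mem
  · rintro a ⟨i, ha⟩ hne
    have haK : a ∉ K := mt (hf0 a).2 hne
    have h1 : (1 : R) ∈ K ⊔ Submodule.span Rᵐᵒᵖ {a} := by
      by_contra h1
      have := hmax _ (isHomogeneous_sup hK (isHomogeneous_span_right i a ha)) le_sup_left h1
      exact haK (this.le (Submodule.mem_sup_right (Submodule.mem_span_singleton_self a)))
    obtain ⟨m, hm, c, hc, hmc⟩ := Submodule.mem_sup.1 h1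
    obtain ⟨b, rfl⟩ := mem_span_right_iff.1 hc
    refine ⟨b, ?_⟩
    rw [mul_assoc, ← zero_add (_ * (a * b)), ← (hf0 m).2 hm, ← mul_add, hmc, mul_one]
  · have := (hf0 (1 - e)).2 (hle (Submodule.mem_span_singleton_self _))
    rw [mul_sub, mul_one, sub_eq_zero] at this
    exact this.symm

variable (𝒜) in
/-- The right annihilator of a graded left ideal. -/
def rightAnnGraded (U : gradedSublattice R 𝒜) : gradedSublattice Rᵐᵒᵖ 𝒜 :=
  ⟨rightAnnIdeal (U.1 : Set R), isHomogeneous_rightAnnIdeal U.2⟩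

variable (𝒜) in
/-- The left annihilator of a graded right ideal. -/
def leftAnnGraded (U : gradedSublattice Rᵐᵒᵖ 𝒜) : gradedSublattice R 𝒜 :=
  ⟨leftAnnIdeal (U.1 : Set R), isHomogeneous_leftAnnIdeal U.2⟩

theorem rightAnnGraded_antitone : Antitone (rightAnnGraded 𝒜) :=
  fun _ _ hUV _ ha x hx => ha x (hUV hx)

theorem leftAnnGraded_antitone : Antitone (leftAnnGraded 𝒜) :=
  fun _ _ hUV _ ha x hx => ha x (hUV hx)

/-- If homomorphisms from simple left ideals to `R` are right multiplications, then taking right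
annihilators reverses weak covers. -/
theorem rightAnnGraded_wcovBy
    (hmul : ∀ p q, IsLeftSimpleElem (SetLike.homogeneousSubmonoid 𝒜) p →
      q ∈ SetLike.homogeneousSubmonoid 𝒜 → (∀ a, a * p = 0 → a * q = 0) → ∃ r, p * r = q)
    (U V : gradedSublattice R 𝒜) (hUV : U ⩿ V) :
    rightAnnGraded 𝒜 V ⩿ rightAnnGraded 𝒜 U := by
  refine ⟨rightAnnGraded_antitone hUV.le, fun W hVW hWU => ?_⟩
  obtain ⟨i, x, hx, hxW, hxV⟩ := exists_homogeneous_of_not_le W.2 (fun h => hVW.not_ge h)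
  refine hWU.not_ge (le_of_forall_homogeneous (rightAnnGraded 𝒜 U).2 fun j y hy hyU => ?_)
  have hxU : x ∈ rightAnnIdeal (U.1 : Set R) := hWU.le hxW
  -- Any homogeneous `u ∈ V` with `u * x ≠ 0` generates `V` modulo `U`, and `V / U ≅ R (u * x)`
  -- through right multiplication by `x`.
  obtain ⟨g, u, hu, huV, hux⟩ : ∃ g, ∃ u ∈ 𝒜 g, u ∈ V.1 ∧ u * x ≠ 0 := by
    by_contra! h
    exact hxV ((le_of_forall_homogeneous V.2 fun g u hu huV => h g u hu huV :
      V.1 ≤ LinearMap.ker (LinearMap.toSpanSingleton R R x)))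
  have huU : u ∉ U.1 := fun h => hux (hxU u h)
  have hx' : (LinearMap.ker (LinearMap.toSpanSingleton R R x)).IsHomogeneous 𝒜 :=
    isHomogeneous_ker (ℳ := 𝒜) (𝒩 := 𝒜) _ (δ := fun g => g + i) (add_left_injective i)
      fun g z hz => SetLike.GradedMul.mul_mem hz hx
  -- an element of `V` killing `x` lies in `U`
  have hVx : ∀ v ∈ V.1, v * x = 0 → v ∈ U.1 := by
    intro v hv hvx
    rcases eq_or_eq_of_wcovBy hUV (isHomogeneous_inf V.2 hx')
      (fun z hz => ⟨hUV.le hz, hxU z hz⟩) inf_le_left with h | h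
    · exact h.le ⟨hv, hvx⟩
    · exact absurd (h.ge huV).2 hux
  -- `V` is generated by `U` and any homogeneous element of `V` outside `U`
  have hgen : ∀ g, ∀ v ∈ 𝒜 g, v ∈ V.1 → v ∉ U.1 → V.1 ≤ U.1 ⊔ Submodule.span R {v} := by
    intro g v hv hvV hvU
    rcases eq_or_eq_of_wcovBy hUV (isHomogeneous_sup U.2 (isHomogeneous_span_left g v hv))
      le_sup_left (sup_le hUV.le ((Submodule.span_singleton_le_iff_mem _ _).2 hvV)) with h | h
    · exact absurd
        (h.le (Submodule.mem_sup_right (Submodule.mem_span_singleton_self v))) hvU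
    · exact h.ge
  have hp : IsLeftSimpleElem (SetLike.homogeneousSubmonoid 𝒜) (u * x) := by
    refine ⟨⟨_, SetLike.GradedMul.mul_mem hu hx⟩, hux, ?_⟩
    rintro a ⟨k, ha⟩ hne
    rw [← mul_assoc] at hne
    obtain ⟨u', hu', c, hc, huc⟩ := Submodule.mem_sup.1
      (hgen _ (a * u) (SetLike.GradedMul.mul_mem ha hu) (V.1.smul_mem a huV)
        (fun h => hne (hxU _ h)) huV)
    obtain ⟨b, rfl⟩ := mem_span_left_iff.1 hc
    refine ⟨b, ?_⟩
    conv_rhs => rw [← huc, add_mul, hxU u' hu', zero_add]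
    simp only [mul_assoc]
  -- The map `a * (u * x) ↦ a * (u * y)` is well defined because `a * u * x = 0` forces `a * u ∈ U`.
  -- Hence `y - x * r` kills both `U` and `u`, that is, all of `V`.
  obtain ⟨r, hr⟩ := hmul (u * x) (u * y) hp ⟨_, SetLike.GradedMul.mul_mem hu hy⟩ (fun a ha => by
    rw [← mul_assoc] at ha ⊢
    exact hyU _ (hVx _ (V.1.smul_mem a huV) ha))
  have hyr : y - x * r ∈ rightAnnIdeal (V.1 : Set R) := by
    intro v hv
    obtain ⟨u', hu', c, hc, rfl⟩ := Submodule.mem_sup.1 (hgen _ u hu huV huU hv)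
    obtain ⟨b, rfl⟩ := mem_span_left_iff.1 hc
    rw [add_mul, mul_sub, hyU u' hu', ← mul_assoc u', hxU u' hu', zero_mul, sub_zero, zero_add,
      mul_assoc, mul_sub, ← mul_assoc u, hr, sub_self, mul_zero]
  rw [← sub_add_cancel y (x * r)]
  exact W.1.add_mem (hVW.le hyr) (W.1.smul_mem (op r) hxW)

/-- If homomorphisms from simple right ideals to `R` are left multiplications, then taking left
annihilators reverses weak covers. -/
theorem leftAnnGraded_wcovBy
    (hmul : ∀ p q, IsRightSimpleElem (SetLike.homogeneousSubmonoid 𝒜) p →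
      q ∈ SetLike.homogeneousSubmonoid 𝒜 → (∀ a, p * a = 0 → q * a = 0) → ∃ r, r * p = q)
    (U V : gradedSublattice Rᵐᵒᵖ 𝒜) (hUV : U ⩿ V) :
    leftAnnGraded 𝒜 V ⩿ leftAnnGraded 𝒜 U := by
  refine ⟨leftAnnGraded_antitone hUV.le, fun W hVW hWU => ?_⟩
  obtain ⟨i, x, hx, hxW, hxV⟩ := exists_homogeneous_of_not_le W.2 (fun h => hVW.not_ge h)
  refine hWU.not_ge (le_of_forall_homogeneous (leftAnnGraded 𝒜 U).2 fun j y hy hyU => ?_)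
  have hxU : x ∈ leftAnnIdeal (U.1 : Set R) := hWU.le hxW
  obtain ⟨g, u, hu, huV, hux⟩ : ∃ g, ∃ u ∈ 𝒜 g, u ∈ V.1 ∧ x * u ≠ 0 := by
    by_contra! h
    exact hxV ((le_of_forall_homogeneous V.2 fun g u hu huV => h g u hu huV :
      V.1 ≤ LinearMap.ker (DistribSMul.toLinearMap Rᵐᵒᵖ R x)))
  have huU : u ∉ U.1 := fun h => hux (hxU u h)
  have hx' : (LinearMap.ker (DistribSMul.toLinearMap Rᵐᵒᵖ R x)).IsHomogeneous 𝒜 :=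
    isHomogeneous_ker (ℳ := 𝒜) (𝒩 := 𝒜) _ (δ := fun g => i + g) (add_right_injective i)
      fun g z hz => SetLike.GradedMul.mul_mem hx hz
  -- an element of `V` killed by `x` lies in `U`
  have hVx : ∀ v ∈ V.1, x * v = 0 → v ∈ U.1 := by
    intro v hv hvx
    rcases eq_or_eq_of_wcovBy hUV (isHomogeneous_inf V.2 hx')
      (fun z hz => ⟨hUV.le hz, hxU z hz⟩) inf_le_left with h | h
    · exact h.le ⟨hv, hvx⟩
    · exact absurd (h.ge huV).2 hux
  -- `V` is generated by `U` and any homogeneous element of `V` outside `U`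
  have hgen : ∀ g, ∀ v ∈ 𝒜 g, v ∈ V.1 → v ∉ U.1 → V.1 ≤ U.1 ⊔ Submodule.span Rᵐᵒᵖ {v} := by
    intro g v hv hvV hvU
    rcases eq_or_eq_of_wcovBy hUV (isHomogeneous_sup U.2 (isHomogeneous_span_right g v hv))
      le_sup_left (sup_le hUV.le ((Submodule.span_singleton_le_iff_mem _ _).2 hvV)) with h | h
    · exact absurd
        (h.le (Submodule.mem_sup_right (Submodule.mem_span_singleton_self v))) hvU
    · exact h.ge
  have hp : IsRightSimpleElem (SetLike.homogeneousSubmonoid 𝒜) (x * u) := by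
    refine ⟨⟨_, SetLike.GradedMul.mul_mem hx hu⟩, hux, ?_⟩
    rintro a ⟨k, ha⟩ hne
    rw [mul_assoc] at hne
    obtain ⟨u', hu', c, hc, huc⟩ := Submodule.mem_sup.1
      (hgen _ (u * a) (SetLike.GradedMul.mul_mem hu ha) (V.1.smul_mem (op a) huV)
        (fun h => hne (hxU _ h)) huV)
    obtain ⟨b, rfl⟩ := mem_span_right_iff.1 hc
    refine ⟨b, ?_⟩
    conv_rhs => rw [← huc, mul_add, hxU u' hu', zero_add]
    simp only [mul_assoc]
  obtain ⟨r, hr⟩ := hmul (x * u) (y * u) hp ⟨_, SetLike.GradedMul.mul_mem hy hu⟩ (fun a ha => by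
    rw [mul_assoc] at ha ⊢
    exact hyU _ (hVx _ (V.1.smul_mem (op a) huV) ha))
  have hyr : y - r * x ∈ leftAnnIdeal (V.1 : Set R) := by
    intro v hv
    obtain ⟨u', hu', c, hc, rfl⟩ := Submodule.mem_sup.1 (hgen _ u hu huV huU hv)
    obtain ⟨b, rfl⟩ := mem_span_right_iff.1 hc
    rw [mul_add, sub_mul, hyU u' hu', mul_assoc r, hxU u' hu', mul_zero, sub_zero, zero_add,
      ← mul_assoc, sub_mul, mul_assoc r, hr, sub_self, zero_mul]
  rw [← sub_add_cancel y (r * x)]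
  exact W.1.add_mem (hVW.le hyr) (W.1.smul_mem r hxW)

theorem isGradedQuasiFrobenius_of_embed_of_existsUnique (hR : IsGradedArtinian 𝒜)
    (hKl : LeftGradedSimplesEmbed 𝒜) (hKr : RightGradedSimplesEmbed 𝒜)
    (hSl : ∀ P : Submodule R R, IsGradedIndecomposableFactor 𝒜 P →
      ∃! N : Submodule R R, N ≤ P ∧ IsGradedSimpleSubmodule 𝒜 N)
    (hSr : ∀ P : Submodule Rᵐᵒᵖ R, IsGradedIndecomposableFactor 𝒜 P →
      ∃! N : Submodule Rᵐᵒᵖ R, N ≤ P ∧ IsGradedSimpleSubmodule 𝒜 N) :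
    IsGradedQuasiFrobenius 𝒜 := by
  obtain ⟨n, e, he, hsum, horth⟩ := hR.exists_primitive_idempotents
  have hs := fun i => exists_isLeftSocleGenerator hR (he i).idem
    (hSl _ (isGradedIndecomposableFactor_left he hsum horth i))
  have ht := fun i => exists_isRightSocleGenerator hR (he i).idem
    (hSr _ (isGradedIndecomposableFactor_right he hsum horth i))
  choose s hs using hs
  choose t ht using ht
  have hl := leftDivisionClosed_homogeneousSubmonoid 𝒜
  have hr := rightDivisionClosed_homogeneousSubmonoid 𝒜
  have hloc := fun i => hR.isLocalIdem (he i)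
  have hdeg := fun i => mem_zero_of_idem (he i).mem (he i).idem
  have hcl := rightAnnGraded_wcovBy fun p q hp hq =>
    exists_mul_eq_of_isLeftSimpleElem hl hr hloc hsum hs ht
      (fun k => hKl.exists_isLeftSimpleElem (hdeg k) (he k).idem (he k).ne_zero) hp hq
  have hcr := leftAnnGraded_wcovBy fun p q hp hq =>
    exists_mul_eq_of_isRightSimpleElem hl hr hloc hsum hs ht
      (fun k => hKr.exists_isRightSimpleElem (hdeg k) (he k).idem (he k).ne_zero) hp hq
  have := hR.1.wellFoundedLT
  have := hR.2.wellFoundedLT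
  refine ⟨hR, fun I hI => ?_, fun U hU => ?_⟩
  -- The remaining goal says that zero is closed: `1` annihilates the zero ideal, so only `0` is
  -- annihilated by all of its annihilator.
  · have := closure_eq_of_wcovBy leftAnnGraded_antitone (g := rightAnnGraded 𝒜)
      (fun U x hx a ha => ha x hx) (bot_unique fun x hx => ?_) hcr hcl ⟨I, hI⟩
    · exact congrArg (fun N : gradedSublattice Rᵐᵒᵖ 𝒜 => (N.1 : Set R)) this
    · have h1 := hx 1 fun y hy => by rw [(Submodule.mem_bot _).1 hy, mul_zero]
      rw [one_mul] at h1
      exact (Submodule.mem_bot _).2 h1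
  · have := closure_eq_of_wcovBy rightAnnGraded_antitone (g := leftAnnGraded 𝒜)
      (fun U x hx a ha => ha x hx) (bot_unique fun x hx => ?_) hcl hcr ⟨U, hU⟩
    · exact congrArg (fun N : gradedSublattice R 𝒜 => (N.1 : Set R)) this
    · have h1 := hx 1 fun y hy => by rw [(Submodule.mem_bot _).1 hy, zero_mul]
      rw [mul_one] at h1
      exact (Submodule.mem_bot _).2 h1

end Kasch

end GradedQF

theorem theorem5p6 {G : Type v} [AddGroup G] [DecidableEq G] {R : Type u} [Ring R]
    (𝒜 : G → AddSubgroup R) [GradedRing 𝒜] (hR : GradedQF.IsGradedArtinian 𝒜) :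
    GradedQF.IsGradedQuasiFrobenius 𝒜 ↔
      (GradedQF.LeftGradedSimplesEmbed 𝒜 ∧ GradedQF.RightGradedSimplesEmbed 𝒜) ∧
      ((∀ P : Submodule R R, GradedQF.IsGradedIndecomposableFactor 𝒜 P →
          ∃! N : Submodule R R, N ≤ P ∧ GradedQF.IsGradedSimpleSubmodule 𝒜 N) ∧
        (∀ P : Submodule Rᵐᵒᵖ R, GradedQF.IsGradedIndecomposableFactor 𝒜 P →
          ∃! N : Submodule Rᵐᵒᵖ R, N ≤ P ∧ GradedQF.IsGradedSimpleSubmodule 𝒜 N)) := by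
  refine ⟨fun h => ⟨⟨h.leftGradedSimplesEmbed, h.rightGradedSimplesEmbed⟩, fun P hP => ?_,
    fun P hP => ?_⟩, fun ⟨⟨hKl, hKr⟩, hSl, hSr⟩ =>
      GradedQF.isGradedQuasiFrobenius_of_embed_of_existsUnique hR hKl hKr hSl hSr⟩
  · obtain ⟨e, he, rfl⟩ := GradedQF.exists_isPrimitiveIdem_left hP
    exact h.existsUnique_left (hR.isLocalIdem he)
  · obtain ⟨e, he, rfl⟩ := GradedQF.exists_isPrimitiveIdem_right hP
    exact h.existsUnique_right (hR.isLocalIdem he)
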